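/- Let $a\in\mathbb N=\{0,1,2,\dots\}$. Given elements $b,c,d,\lambda$ of a commutative ring (real numbers or indeterminates, as specified in each part), let $[T_{n,k}]_{n,k\ge 0}$ be the lower-triangular array with $T_{0,0}=1$, $T_{n,k}=0$ for $k>n$, and $$T_{n,k}=c\,T_{n-1,k-1}+\bigl[ab(n-1)+bk+abd+c\lambda\bigr]T_{n-1,k}+b\lambda(k+1)\,T_{n-1,k+1}\qquad(n\ge 1,\ k\ge 0),$$ where $T_{n-1,-1}=0$ (the generalized Lah triangle). Let $T_n(q)=\sum_{k=0}^n T_{n,k}q^k$. Terminology. For a set $\mathbf x$ of indeterminates, an infinite matrix over $\mathbb R[\mathbf x]$ is $\mathbf x$-TP if all its minors are polynomials with nonnegative coefficients; a sequence $(\alpha_n)_{n\ge0}$ in $\mathbb R[\mathbf x]$ is $\mathbf x$-SM if its Hankel matrix $[\alpha_{i+j}]_{i,j\ge0}$ is $\mathbf x$-TP, and is $3$-$\mathbf x$-log-convex if $\mathcal L^m[\alpha_i]$ has nonnegative coefficients for all $m\le 3$ and all $i\geq m$, where $\mathcal L[\alpha_i]=\alpha_{i-1}\alpha_{i+1}-\alpha_i^2$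 and $\mathcal L^m=\mathcal L(\mathcal L^{m-1})$. A real sequence $(\alpha_n)_{n\ge 0}$ is SM if $\alpha_n=\int_0^\infty x^n\,d\mu(x)$ for all $n\ge0$, for some nonnegative measure $\mu$ on $[0,\infty)$ with finite moments. A real sequence is PF if all minors of its Toeplitz matrix $[\alpha_{i-j}]_{i,j\ge0}$ are nonnegative (with $\alpha_n=0$ outside its index range). Write $(x)_n=x(x-1)\cdots(x-n+1)$. Then the following hold. (i) For real $b,c,d,\lambda$ and all $n,k\ge0$, $$T_{n,k}=\frac{a^n}{k!}\sum_{j\ge0}\sum_{i=0}^{k+j}\frac{(-1)^{n+k+j-i}\,b^{n-k-j}c^{k+j}\lambda^j}{j!}\binom{k+j}{i}\Bigl(-\frac{i+ad}{a}\Bigr)_n .$$ Here, for $a=0$, the product $a^n\bigl(-\frac{i+ad}{a}\bigr)_n=\prod_{r=0}^{n-1}(-(i+ad)-ra)$ is read as $(-i)^n$ (with $0^0=1$). For $k+j>n$ the inner sum over $i$ vanishes, so these terms are $0$, also when $b=0$. (ii) For $d\in\mathbb N$ and real $c>0$, with $b,\lambda$ indeterminates, $[T_{n,k}]_{n,k\ge0}$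 is $(b,\lambda)$-TP. (iii) For $c=b$, with $b,d,\lambda$ indeterminates, $[T_{n,k}]_{n,k\ge0}$ is $(b,d,\lambda)$-TP. (iv) For $c=b$, with $b,d,\lambda,q$ indeterminates, $(T_n(q))_{n\ge0}$ is $(b,d,\lambda,q)$-SM and $3$-$(b,d,\lambda,q)$-log-convex. In particular, $(T_{n,0})_{n\ge0}$ is $(b,d,\lambda)$-SM and $3$-$(b,d,\lambda)$-log-convex. (v) For real $b>0$, the sequence $(f_n)_{n\ge1}$ given by $\sum_{n\ge1}f_n\frac{t^n}{n!}=\frac{(1-abt)^{-1/a}-1}{b}$ (read as its limit $\frac{e^{bt}-1}{b}$ if $a=0$) is SM, i.e. $(f_{n+1})_{n\ge0}$ is SM. (vi) Let $c=b$ and let $b,d,\lambda\ge0$ be real. If $(x_n)_{n\ge0}$ and $(y_n)_{n\ge0}$ are SM, then so is $z_n=\sum_{k=0}^n T_{n,k}x_ky_{n-k}$. (vii) Let $m=a+1$, $d=0$, and let $b,c,\lambda$ be real. In $\mathbb R[q][[t]]$, $$\sum_{n\ge0}T_n(q)t^n=\cfrac{1}{1-\alpha_m t\prod\limits_{i_1=1}^m\cfrac{1}{1-\alpha_{m+i_1}t\prod\limits_{i_2=1}^m\cfrac{1}{1-\alpha_{m+i_1+i_2}t\prod\limits_{i_3=1}^m\cfrac{1}{1-\cdots}}}}$$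 with $(\alpha_i)_{i\ge m}=(c(q+\lambda),\underbrace{b,\dots,b}_{m},c(q+\lambda),\underbrace{2b,\dots,2b}_{m},c(q+\lambda),\underbrace{3b,\dots,3b}_{m},\dots)$; the infinite fraction is the coefficientwise limit of its truncations. In particular, $\sum_{n\ge0}T_{n,0}t^n$ has the same type of expansion in $\mathbb R[[t]]$, with $c(q+\lambda)$ replaced by $c\lambda$. (viii) For real $b,c,d,\lambda\ge0$ and every $n$, the row $(T_{n,k})_{k=0}^n$ is a PF sequence, and $T_n(q)$, unless identically zero, has only real zeros. -/

import Mathlib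

open Finset

/-- `T` is the generalized Lah triangle with parameters `a, b, c, d, l`, over any commutative ring:
the lower triangular array with `T 0 0 = 1` and
`T_{n,k} = c T_{n-1,k-1} + [ab(n-1) + bk + abd + cl] T_{n-1,k} + bl(k+1) T_{n-1,k+1}`
for `n ≥ 1`, `k ≥ 0`, where `T_{n-1,-1} = 0`. -/
structure IsGenLahTriangle {R : Type*} [CommRing R] (a : ℕ) (b c d l : R) (T : ℕ → ℕ → R) :
    Prop where
  init : T 0 0 = 1
  lower : ∀ n k, n < k → T n k = 0
  rec_zero : ∀ n : ℕ,
    T (n + 1) 0 = (a * b * n + a * b * d + c * l) * T n 0 + b * l * T n 1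
  rec_succ : ∀ n k : ℕ,
    T (n + 1) (k + 1) = c * T n k
      + (a * b * n + b * ((k + 1 : ℕ) : R) + a * b * d + c * l) * T n (k + 1)
      + b * l * ((k + 2 : ℕ) : R) * T n (k + 2)

/-- The row-generating polynomial `T_n(q) = ∑_{k ≤ n} T_{n,k} q^k`. -/
noncomputable def rowPoly {R : Type*} [CommRing R] (T : ℕ → ℕ → R) (n : ℕ) : Polynomial R :=
  ∑ k ∈ range (n + 1), Polynomial.C (T n k) * Polynomial.X ^ k

/-- A polynomial all of whose coefficients are nonnegative. -/
def NonnegCoeffs {σ : Type*} (p : MvPolynomial σ ℝ) : Prop :=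
  ∀ e : σ →₀ ℕ, 0 ≤ p.coeff e

/-- An infinite matrix is totally positive: all minors are nonnegative. -/
def IsTP (M : ℕ → ℕ → ℝ) : Prop :=
  ∀ (r : ℕ) (rows cols : Fin r → ℕ), StrictMono rows → StrictMono cols →
    0 ≤ (Matrix.of fun i j => M (rows i) (cols j)).det

/-- An infinite matrix over `ℝ[x]` is `x`-totally positive: all minors have nonnegative
coefficients in the indeterminates `x = (x_s)_{s ∈ σ}`. -/
def IsXTP {σ : Type*} (M : ℕ → ℕ → MvPolynomial σ ℝ) : Prop :=
  ∀ (r : ℕ) (rows cols : Fin r → ℕ), StrictMono rows → StrictMono cols →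
    NonnegCoeffs (Matrix.of fun i j => M (rows i) (cols j)).det

/-- An `x`-Stieltjes moment sequence: its Hankel matrix is `x`-totally positive. -/
def IsXSM {σ : Type*} (α : ℕ → MvPolynomial σ ℝ) : Prop :=
  IsXTP fun i j => α (i + j)

/-- The operator `ℒ[α_i] = α_{i-1} α_{i+1} - α_i ^ 2`, re-indexed so that the result again starts
at index `0`. -/
def logConvexOp {R : Type*} [CommRing R] (α : ℕ → R) : ℕ → R :=
  fun i => α i * α (i + 2) - α (i + 1) ^ 2

/-- `k`-`x`-log-convexity: `ℒ^m[α_i]` has nonnegative coefficients for all `m ≤ k`. -/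
def IsXLogConvexOfOrder {σ : Type*} (k : ℕ) (α : ℕ → MvPolynomial σ ℝ) : Prop :=
  ∀ m ≤ k, ∀ i, NonnegCoeffs (logConvexOp^[m] α i)

/-- A real Stieltjes moment sequence: `α_k = ∫ x^k dμ` for a nonnegative measure `μ` on `[0, ∞)`
with finite moments. -/
def IsStieltjesMoment (α : ℕ → ℝ) : Prop :=
  ∃ μ : MeasureTheory.Measure ℝ, μ (Set.Iio 0) = 0 ∧
    ∀ k : ℕ, MeasureTheory.Integrable (fun x : ℝ => x ^ k) μ ∧ α k = ∫ x, x ^ k ∂μ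

/-- The convolution `z_n = ∑_{k ≤ n} A_{n,k} x_k y_{n-k}` preserves Stieltjes moment sequences. -/
def PreservesSM (A : ℕ → ℕ → ℝ) : Prop :=
  ∀ x y : ℕ → ℝ, IsStieltjesMoment x → IsStieltjesMoment y →
    IsStieltjesMoment fun n => ∑ k ∈ range (n + 1), A n k * x k * y (n - k)

/-- A Pólya frequency sequence: its Toeplitz matrix `[α_{i-j}]` is totally positive. -/
def IsPF (α : ℕ → ℝ) : Prop :=
  IsTP fun i j => if j ≤ i then α (i - j) else 0

/-- Truncation at depth `N` of the `m`-branched Stieltjes-type continued fraction whose topmost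
coefficient is `α (k + m)`:
`F_0(k) = 1` and `F_{N+1}(k) = 1 / (1 - α_{k+m} t ∏_{i=1}^m F_N(k+i))`. -/
noncomputable def branchedTrunc {R : Type*} [CommRing R] (m : ℕ) (α : ℕ → R) :
    ℕ → ℕ → PowerSeries R
  | 0, _ => 1
  | N + 1, k =>
      PowerSeries.invOfUnit
        (1 - PowerSeries.C (α (k + m)) * PowerSeries.X *
          ∏ i ∈ Icc 1 m, branchedTrunc m α N (k + i)) 1

/-- `F` is the value of the `m`-branched Stieltjes-type continued fraction with coefficients
`(α_i)_{i ≥ m}`: the truncations converge to `F` coefficientwise (each coefficient is eventually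
constant). -/
def IsBranchedSFraction {R : Type*} [CommRing R] (m : ℕ) (α : ℕ → R) (F : PowerSeries R) :
    Prop :=
  ∀ n : ℕ, ∃ N₀ : ℕ, ∀ N ≥ N₀,
    PowerSeries.coeff n (branchedTrunc m α N 0) = PowerSeries.coeff n F

/-- The sequence `(α_i)_{i ≥ m} = (u, b, …, b, u, 2b, …, 2b, u, 3b, …, 3b, u, …)` with blocks of
length `m`; its values at `i < m` are irrelevant. -/
def branchedCoeffs {R : Type*} [CommRing R] (m : ℕ) (u b : R) (i : ℕ) : R :=
  if (i - m) % (m + 1) = 0 then u else (((i - m) / (m + 1) + 1 : ℕ) : R) * b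

/-!
Write `b = u c`. The row polynomials satisfy `T_{n+1} = (a b (n + d) + E) T_n`, where
`E = c (X + l) (1 + u D)` and `D = d/dX`. Since `(1 + u D) E = (E + b) (1 + u D)`, the dependence
on `n` can be absorbed into a power of `1 + u D`: `T_{n+1} = P T_n` with the production operator
`P = (a b d + E) (1 + u D) ^ a`. In the monomial basis `P` is a product of bidiagonal matrices, up
to a nonnegative multiple of the identity added to the tridiagonal `E`, so it is totally positive.
By the Cauchy–Binet formula so are the triangle and the Hankel matrix of its column 0, and
evaluation at `q` only shifts `l` to `l + q`.

The functional sending `X ^ j` to the falling factorial `x (x - 1) ⋯ (x - j + 1)` turns `T_n`, for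
`b = c = 1` and `l = 0`, into a rising product in `x`; binomial inversion gives the explicit
formula. That functional is integration against a Poisson law, so the convolution with moment
sequences becomes a Poisson mixture of products with Gamma moments.

The branched continued fraction comes from an Euler–Gauss recurrence between the series
`∑ n, [X ^ j] (1 + b D) ^ r T_{n+j} t ^ n`, with `c = 1`, whose three-term relations are
`T_{n+1} = (X + l) (1 + b D) ^ (a + 1) T_n` and the action of `1 + b D` on coefficients. The zeros
of `T_n` stay real because `f ↦ γ f + X (c f + b f')` preserves real-rootedness of polynomials with
nonpositive zeros.
-/
section Minors

variable {R : Type*} [CommRing R] {N : Subsemiring R}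

/-- All minors of the matrix `M` lie in the subsemiring `N`. This is total positivity for the
nonnegative elements of an ordered ring, and `x`-total positivity for the polynomials with
nonnegative coefficients. -/
def HasMinorsIn {ι κ : Type*} [Preorder ι] [Preorder κ] (N : Subsemiring R) (M : Matrix ι κ R) :
    Prop :=
  ∀ (r : ℕ) (rows : Fin r → ι) (cols : Fin r → κ), StrictMono rows → StrictMono cols →
    (M.submatrix rows cols).det ∈ N

-- The Cauchy–Binet formula, in the guise of the expansion of `v 0 ∧ ⋯ ∧ v (r - 1)` in the basis of
-- the exterior power induced by `B`.
theorem det_dual_apply_mem {V I : Type*} [AddCommGroup V] [Module R V] [LinearOrder I]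
    (B : Module.Basis I R V) {r : ℕ} {v : Fin r → V} {φ : Fin r → Module.Dual R V}
    (hv : ∀ κ : Fin r → I, StrictMono κ → (Matrix.of fun i j => B.repr (v i) (κ j)).det ∈ N)
    (hφ : ∀ κ : Fin r → I, StrictMono κ → (Matrix.of fun i j => φ j (B (κ i))).det ∈ N) :
    (Matrix.of fun i j => φ j (v i)).det ∈ N := by
  let f : V [⋀^Fin r]→ₗ[R] R := Matrix.detRowAlternating.compLinearMap (LinearMap.pi φ)
  have expansion := congrArg (exteriorPower.alternatingMapLinearEquiv f)
    ((B.exteriorPower r).linearCombination_repr (exteriorPower.ιMulti R r v))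
  rw [exteriorPower.alternatingMapLinearEquiv_apply_ιMulti, Finsupp.linearCombination_apply,
    Finsupp.sum, map_sum] at expansion
  change f v ∈ N
  rw [← expansion]
  refine sum_mem fun s _ => ?_
  rw [map_smul, exteriorPower.basis_repr_apply, exteriorPower.ιMultiDual_apply_ιMulti,
    exteriorPower.basis_apply, exteriorPower.ιMulti_family,
    exteriorPower.alternatingMapLinearEquiv_apply_ιMulti]
  exact N.mul_mem (hv _ (OrderEmbedding.strictMono _)) (hφ _ (OrderEmbedding.strictMono _))

namespace HasMinorsIn

section Preorder

variable {ι κ : Type*} [Preorder ι] [Preorder κ] {M : Matrix ι κ R}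

theorem transpose (h : HasMinorsIn N M) : HasMinorsIn N M.transpose := by
  intro r rows cols hrows hcols
  rw [← Matrix.transpose_submatrix, Matrix.det_transpose]
  exact h r cols rows hcols hrows

theorem apply_mem (h : HasMinorsIn N M) (i : ι) (j : κ) : M i j ∈ N := by
  simpa using h 1 (fun _ => i) (fun _ => j) (Subsingleton.strictMono _) (Subsingleton.strictMono _)

theorem dual_apply {V I : Type*} [AddCommGroup V] [Module R V] [LinearOrder I]
    (B : Module.Basis I R V) {v : ι → V} {φ : κ → Module.Dual R V}
    (hv : HasMinorsIn N (Matrix.of fun i k => B.repr (v i) k))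
    (hφ : HasMinorsIn N (Matrix.of fun k j => φ j (B k))) :
    HasMinorsIn N (Matrix.of fun i j => φ j (v i)) := fun r rows cols hrows hcols =>
  det_dual_apply_mem B (fun κ hκ => hv r rows κ hrows hκ) fun κ hκ => hφ r κ cols hκ hcols

end Preorder

theorem det_submatrix_mem_of_row_zero {M : Matrix ℕ ℕ R}
    (hzero : ∀ k, M 0 k = if k = 0 then 1 else 0) {r : ℕ} {rows cols : Fin r → ℕ}
    (hrows : StrictMono rows) (hcols : StrictMono cols)
    (hmem : ∀ (s : ℕ) (rows' cols' : Fin s → ℕ), StrictMono rows' → StrictMono cols' →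
      (∀ i, 0 < rows' i) → (∀ i, ∃ j, rows' i = rows j) → (M.submatrix rows' cols').det ∈ N) :
    (M.submatrix rows cols).det ∈ N := by
  by_cases hpos : ∀ i, 0 < rows i
  · exact hmem r rows cols hrows hcols hpos fun i => ⟨i, rfl⟩
  obtain ⟨i₀, hi₀⟩ := not_forall.1 hpos
  obtain ⟨r, rfl⟩ : ∃ s, r = s + 1 := ⟨r - 1, by have := i₀.is_lt; omega⟩
  have hrow : rows 0 = 0 := by have := hrows.monotone (Fin.zero_le i₀); omega
  have hcol : ∀ j ≠ 0, cols j ≠ 0 := fun j hj => by have := hcols (Fin.pos_of_ne_zero hj); omega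
  rw [Matrix.det_succ_row_zero, sum_eq_single 0 (fun j _ hj => by simp [hrow, hzero, hcol j hj])
    (by simp)]
  by_cases hcol₀ : cols 0 = 0
  · simp only [Fin.val_zero, pow_zero, Matrix.submatrix_apply, hrow, hcol₀, hzero, if_true, one_mul]
    exact hmem r (rows ∘ Fin.succ) (cols ∘ Fin.succ) (hrows.comp Fin.strictMono_succ)
      (hcols.comp Fin.strictMono_succ) (fun i => (Nat.zero_le _).trans_lt (hrows (Fin.succ_pos i)))
      fun i => ⟨i.succ, rfl⟩
  · simp [hrow, hzero, hcol₀]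

theorem of_row_shift {M : Matrix ℕ ℕ R} (hzero : ∀ k, M 0 k = if k = 0 then 1 else 0)
    (hshift : ∀ (r : ℕ) (rows : Fin r → ℕ), StrictMono rows →
      (∀ cols : Fin r → ℕ, StrictMono cols → (M.submatrix rows cols).det ∈ N) →
      ∀ cols : Fin r → ℕ, StrictMono cols →
        (M.submatrix (fun i => rows i + 1) cols).det ∈ N) :
    HasMinorsIn N M := by
  have bounded : ∀ (n r : ℕ) (rows cols : Fin r → ℕ), StrictMono rows → StrictMono cols →
      (∀ i, rows i < n) → (M.submatrix rows cols).det ∈ N := by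
    intro n
    induction n with
    | zero =>
      rintro (_ | r) rows cols _ _ hlt
      · simp
      · exact absurd (hlt 0) (Nat.not_lt_zero _)
    | succ n ih =>
      intro r rows cols hrows hcols hlt
      refine det_submatrix_mem_of_row_zero hzero hrows hcols
        fun s rows' cols' hrows' hcols' hpos hsub => ?_
      obtain ⟨pred, rfl⟩ : ∃ pred : Fin s → ℕ, rows' = fun i => pred i + 1 :=
        ⟨fun i => rows' i - 1, funext fun i => (Nat.sub_add_cancel (hpos i)).symm⟩
      have hpred : StrictMono pred := fun i j hij => Nat.lt_of_succ_lt_succ (hrows' hij)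
      refine hshift s pred hpred (fun κ hκ => ih s pred κ hpred hκ fun i => ?_) cols' hcols'
      obtain ⟨j, hj⟩ := hsub i
      exact Nat.lt_of_succ_lt_succ (hj.trans_lt (hlt j))
  intro r rows cols hrows hcols
  exact bounded (∑ i, rows i + 1) r rows cols hrows hcols fun i =>
    Nat.lt_succ_of_le (single_le_sum_of_canonicallyOrdered (mem_univ i))

theorem of_bidiagonal {M : Matrix ℕ ℕ R} (hmem : ∀ i j, M i j ∈ N)
    (hzero : ∀ i j, j ≠ i → j ≠ i + 1 → M i j = 0) : HasMinorsIn N M := by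
  intro r
  induction r with
  | zero => simp
  | succ r ih =>
    intro rows cols hrows hcols
    have hminor := ih (rows ∘ Fin.succ) (cols ∘ Fin.succ) (hrows.comp Fin.strictMono_succ)
      (hcols.comp Fin.strictMono_succ)
    have hrows₀ : ∀ i ≠ 0, rows 0 < rows i := fun i hi => hrows (Fin.pos_of_ne_zero hi)
    have hcols₀ : ∀ j ≠ 0, cols 0 < cols j := fun j hj => hcols (Fin.pos_of_ne_zero hj)
    by_cases hle : cols 0 ≤ rows 0
    · rw [Matrix.det_succ_column_zero, sum_eq_single 0 (fun i _ hi => by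
        have := hrows₀ i hi
        simp [hzero (rows i) (cols 0) (by omega) (by omega)]) (by simp)]
      simpa using N.mul_mem (hmem (rows 0) (cols 0)) hminor
    · rw [Matrix.det_succ_row_zero, sum_eq_single 0 (fun j _ hj => by
        have := hcols₀ j hj
        simp [hzero (rows 0) (cols j) (by omega) (by omega)]) (by simp)]
      simpa using N.mul_mem (hmem (rows 0) (cols 0)) hminor

end HasMinorsIn

theorem det_eq_zero_of_card_lt {n : Type*} [Fintype n] [DecidableEq n] {M : Matrix n n R}
    {I J : Finset n} (hcard : #J < #I) (hzero : ∀ i ∈ I, ∀ j ∉ J, M i j = 0) : M.det = 0 := by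
  rw [← Matrix.det_transpose, Matrix.det_apply]
  refine sum_eq_zero fun σ _ => ?_
  obtain ⟨i, hi, hj⟩ : ∃ i ∈ I, σ i ∉ J := by
    by_contra! hmaps
    exact absurd (card_le_card_of_injOn σ hmaps σ.injective.injOn) (not_le.2 hcard)
  rw [prod_eq_zero (mem_univ i) (by simpa using hzero i hi _ hj), smul_zero]

theorem det_submatrix_succAbove_eq_zero_of_lt {r : ℕ} {A : Matrix (Fin (r + 1)) (Fin (r + 1)) R}
    {p q : Fin (r + 1)} (hpq : p < q) (hzero : ∀ i j, p < i → j < q → A i j = 0) :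
    (A.submatrix p.succAbove q.succAbove).det = 0 := by
  refine det_eq_zero_of_card_lt (I := {i | p ≤ i.castSucc}) (J := {j | q ≤ j.castSucc})
    (card_lt_card ?_) fun i hi j hj => hzero _ _ ?_ ?_
  · refine ⟨fun j hj => ?_, fun hsub => ?_⟩
    · simp only [mem_filter, mem_univ, true_and] at hj ⊢
      exact hpq.le.trans hj
    · have := hsub (show p.castPred (Fin.ne_last_of_lt hpq) ∈ _ by simp)
      simp only [mem_filter, mem_univ, true_and, Fin.castSucc_castPred] at this
      exact this.not_gt hpq
  · simp only [mem_filter, mem_univ, true_and] at hi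
    exact (Fin.lt_succAbove_iff_le_castSucc _ _).2 hi
  · simp only [mem_filter, mem_univ, true_and, not_le] at hj
    exact (Fin.succAbove_lt_iff_castSucc_lt _ _).2 hj

theorem det_add_single {n : ℕ} (A : Matrix (Fin (n + 1)) (Fin (n + 1)) R) (p q : Fin (n + 1))
    (β : R) : (A + Matrix.single p q β).det =
      A.det + β * ((-1) ^ (p + q : ℕ) * (A.submatrix p.succAbove q.succAbove).det) := by
  have hrow : A + Matrix.single p q β = A.updateRow p (A p + β • Pi.single q 1) := by
    ext i j
    rcases eq_or_ne i p with rfl | hi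
    · rcases eq_or_ne j q with rfl | hj
      · simp
      · simp [hj, hj.symm]
    · simp [hi, hi.symm]
  rw [hrow, Matrix.det_updateRow_add, Matrix.updateRow_eq_self, Matrix.det_updateRow_smul,
    ← Matrix.adjugate_apply, Matrix.adjugate_fin_succ_eq_det_submatrix]

namespace HasMinorsIn

variable {M : Matrix ℕ ℕ R}

theorem det_submatrix_succAbove_mem (hM : HasMinorsIn N M)
    (htri : ∀ i j, i + 1 < j ∨ j + 1 < i → M i j = 0) {r : ℕ} {rows cols : Fin (r + 1) → ℕ}
    (hrows : StrictMono rows) (hcols : StrictMono cols) {p q : Fin (r + 1)}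
    (hpq : rows p = cols q) :
    (-1) ^ (p + q : ℕ) *
      ((M.submatrix rows cols).submatrix p.succAbove q.succAbove).det ∈ N := by
  rcases lt_trichotomy p q with hlt | rfl | hgt
  · have hzero : ∀ i j, p < i → j < q → M.submatrix rows cols i j = 0 := fun i j hi hj =>
      htri _ _ (by have := hrows hi; have := hcols hj; omega)
    rw [det_submatrix_succAbove_eq_zero_of_lt hlt hzero, mul_zero]
    exact N.zero_mem
  · rw [Even.neg_one_pow ⟨p, rfl⟩, one_mul]
    exact hM r _ _ (hrows.comp (Fin.strictMono_succAbove p))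
      (hcols.comp (Fin.strictMono_succAbove p))
  · have hzero : ∀ j i, q < j → i < p → (M.submatrix rows cols).transpose j i = 0 :=
      fun j i hj hi => htri _ _ (by have := hcols hj; have := hrows hi; omega)
    rw [← Matrix.det_transpose, Matrix.transpose_submatrix,
      det_submatrix_succAbove_eq_zero_of_lt hgt hzero, mul_zero]
    exact N.zero_mem

theorem add_single_self (hM : HasMinorsIn N M)
    (htri : ∀ i j, i + 1 < j ∨ j + 1 < i → M i j = 0) (k : ℕ) {β : R} (hβ : β ∈ N) :
    HasMinorsIn N (M + Matrix.single k k β) := by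
  intro r rows cols hrows hcols
  by_cases hk : (∃ p, rows p = k) ∧ ∃ q, cols q = k
  · obtain ⟨⟨p, hp⟩, q, hq⟩ := hk
    obtain ⟨r, rfl⟩ : ∃ s, r = s + 1 := ⟨r - 1, by have := p.is_lt; omega⟩
    have hsub : (M + Matrix.single k k β).submatrix rows cols
        = M.submatrix rows cols + Matrix.single p q β := by
      ext i j
      have hi : k = rows i ↔ p = i := by rw [← hp, hrows.injective.eq_iff]
      have hj : k = cols j ↔ q = j := by rw [← hq, hcols.injective.eq_iff]
      simp [Matrix.single_apply, hi, hj]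
    rw [hsub, det_add_single]
    exact N.add_mem (hM _ _ _ hrows hcols)
      (N.mul_mem hβ (hM.det_submatrix_succAbove_mem htri hrows hcols (hp.trans hq.symm)))
  · have hsub : (M + Matrix.single k k β).submatrix rows cols = M.submatrix rows cols := by
      ext i j
      have : ¬(k = rows i ∧ k = cols j) := fun h => hk ⟨⟨i, h.1.symm⟩, j, h.2.symm⟩
      simp [this]
    rw [hsub]
    exact hM r rows cols hrows hcols

theorem add_diagonal (hM : HasMinorsIn N M) (htri : ∀ i j, i + 1 < j ∨ j + 1 < i → M i j = 0)
    {β : ℕ → R} (hβ : ∀ k, β k ∈ N) : HasMinorsIn N (M + Matrix.diagonal β) := by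
  have truncated : ∀ K : ℕ,
      HasMinorsIn N (M + Matrix.diagonal fun k => if k < K then β k else 0) := by
    intro K
    induction K with
    | zero => simpa using hM
    | succ K ih =>
      have hsucc : (Matrix.diagonal fun k => if k < K + 1 then β k else 0)
          = (Matrix.diagonal fun k => if k < K then β k else 0) + Matrix.single K K (β K) := by
        rw [← Matrix.diagonal_single, Matrix.diagonal_add]
        congr 1
        ext k
        rcases lt_trichotomy k K with h | rfl | h
        · simp [h, h.ne, Nat.lt_succ_of_lt h]
        · simp
        · simp [h.ne', not_lt.2 h.le, Nat.not_lt.2 (Nat.succ_le_of_lt h)]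
      rw [hsucc, ← add_assoc]
      refine ih.add_single_self (fun i j hij => ?_) K (hβ K)
      simp [htri i j hij, Matrix.diagonal_apply_ne _ (show i ≠ j by omega)]
  intro r rows cols hrows hcols
  convert truncated (∑ i, rows i + 1) r rows cols hrows hcols using 2
  ext i j
  have : rows i < ∑ i, rows i + 1 :=
    Nat.lt_succ_of_le (single_le_sum_of_canonicallyOrdered (mem_univ i))
  simp [Matrix.diagonal_apply, Nat.le_of_lt_succ this]

end HasMinorsIn

end Minors

section PolynomialOperators

open Polynomial

variable {R : Type*} [CommRing R] {N : Subsemiring R}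

/-- The matrix of an operator on polynomials in the monomial basis; row `i` holds the coefficients
of the image of `X ^ i`. -/
noncomputable def monomialMatrix (A : Module.End R R[X]) : Matrix ℕ ℕ R :=
  Matrix.of fun i j => (A (X ^ i)).coeff j

theorem HasMinorsIn.monomialMatrix_mul {A B : Module.End R R[X]}
    (hA : HasMinorsIn N (monomialMatrix A)) (hB : HasMinorsIn N (monomialMatrix B)) :
    HasMinorsIn N (monomialMatrix (B * A)) :=
  HasMinorsIn.dual_apply (basisMonomials R) (v := fun i => A (X ^ i))
    (φ := fun j => lcoeff R j ∘ₗ B) hA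
    (by simp only [coe_basisMonomials, monomial_one_right_eq_X_pow]; exact hB)

theorem hasMinorsIn_monomialMatrix_mulLeft_linear {c e : R} (hc : c ∈ N) (he : e ∈ N) :
    HasMinorsIn N (monomialMatrix (LinearMap.mulLeft R (C c * X + C e))) := by
  have hentry : ∀ i j, monomialMatrix (LinearMap.mulLeft R (C c * X + C e)) i j
      = (if j = i + 1 then c else 0) + if j = i then e else 0 := fun i j => by
    simp [monomialMatrix, add_mul, mul_assoc, ← pow_succ', coeff_X_pow]
  refine HasMinorsIn.of_bidiagonal (fun i j => ?_) fun i j hj hj' => ?_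
  · rw [hentry]
    refine N.add_mem ?_ ?_ <;> split_ifs
    exacts [hc, N.zero_mem, he, N.zero_mem]
  · rw [hentry, if_neg hj', if_neg hj, add_zero]

theorem hasMinorsIn_monomialMatrix_one :
    HasMinorsIn N (monomialMatrix (1 : Module.End R R[X])) := by
  have h := hasMinorsIn_monomialMatrix_mulLeft_linear N.zero_mem N.one_mem
  rw [C_0, C_1, zero_mul, zero_add, LinearMap.mulLeft_one] at h
  exact h

theorem HasMinorsIn.monomialMatrix_pow {A : Module.End R R[X]}
    (hA : HasMinorsIn N (monomialMatrix A)) (n : ℕ) : HasMinorsIn N (monomialMatrix (A ^ n)) := by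
  induction n with
  | zero => exact hasMinorsIn_monomialMatrix_one
  | succ n ih => rw [pow_succ']; exact ih.monomialMatrix_mul hA

theorem hasMinorsIn_coeff_pow_apply_one {A : Module.End R R[X]}
    (hA : HasMinorsIn N (monomialMatrix A)) :
    HasMinorsIn N (Matrix.of fun n k => ((A ^ n) 1).coeff k) := by
  refine HasMinorsIn.of_row_shift (fun k => by simp [coeff_one])
    fun r rows _ hmem cols hcols => ?_
  have h := det_dual_apply_mem (N := N) (basisMonomials R) (v := fun i => (A ^ rows i) 1)
    (φ := fun j => lcoeff R (cols j) ∘ₗ A) hmem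
    fun κ hκ => by
      simp only [coe_basisMonomials, monomial_one_right_eq_X_pow]
      exact hA r κ cols hκ hcols
  convert h using 2
  ext i j
  simp [pow_succ']

theorem hasMinorsIn_coeff_zero_pow_apply {A : Module.End R R[X]}
    (hA : HasMinorsIn N (monomialMatrix A)) :
    HasMinorsIn N (Matrix.of fun n k => ((A ^ n) (X ^ k)).coeff 0) := by
  refine HasMinorsIn.of_row_shift (fun k => by simp [coeff_X_pow, eq_comm])
    fun r rows _ hmem cols hcols => ?_
  have h := det_dual_apply_mem (N := N) (basisMonomials R) (v := fun i => A (X ^ cols i))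
    (φ := fun j => lcoeff R 0 ∘ₗ (A ^ rows j)) (fun κ hκ => hA r cols κ hcols hκ)
    fun κ hκ => by
      rw [← Matrix.det_transpose]
      simp only [coe_basisMonomials, monomial_one_right_eq_X_pow]
      exact hmem κ hκ
  rw [← Matrix.det_transpose]
  convert h using 2
  ext i j
  simp [pow_succ]

theorem hasMinorsIn_hankel_pow_apply_one {A : Module.End R R[X]}
    (hA : HasMinorsIn N (monomialMatrix A)) :
    HasMinorsIn N (Matrix.of fun i j => ((A ^ (i + j)) 1).coeff 0) := by
  have h := HasMinorsIn.dual_apply (basisMonomials R) (v := fun i => (A ^ i) 1)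
    (φ := fun j => lcoeff R 0 ∘ₗ (A ^ j)) (hasMinorsIn_coeff_pow_apply_one hA)
    (by
      simp only [coe_basisMonomials, monomial_one_right_eq_X_pow]
      exact (hasMinorsIn_coeff_zero_pow_apply hA).transpose)
  have hpow : ∀ i j, (A ^ (i + j)) 1 = (A ^ j) ((A ^ i) 1) := fun i j => by
    rw [add_comm, pow_add, Module.End.mul_apply]
  simp only [hpow]
  exact h

/-- The operator `1 + u d/dX` on polynomials. -/
noncomputable def oneAddDeriv (u : R) : Module.End R R[X] :=
  1 + u • derivative

theorem oneAddDeriv_apply (u : R) (p : R[X]) : oneAddDeriv u p = p + C u * derivative p := by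
  simp [oneAddDeriv, smul_eq_C_mul]

theorem coeff_oneAddDeriv (u : R) (p : R[X]) (k : ℕ) :
    (oneAddDeriv u p).coeff k = p.coeff k + u * (k + 1) * p.coeff (k + 1) := by
  rw [oneAddDeriv_apply, coeff_add, coeff_C_mul, coeff_derivative]
  ring

theorem oneAddDeriv_pow_apply_one (u : R) (n : ℕ) : (oneAddDeriv u ^ n) 1 = 1 := by
  induction n with
  | zero => simp
  | succ n ih => simp [pow_succ', ih, oneAddDeriv_apply]

theorem monomialMatrix_oneAddDeriv (u : R) (i j : ℕ) :
    monomialMatrix (oneAddDeriv u) i j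
      = if j = i then 1 else if i = j + 1 then u * (j + 1) else 0 := by
  rw [monomialMatrix, Matrix.of_apply, coeff_oneAddDeriv, coeff_X_pow, coeff_X_pow]
  rcases eq_or_ne j i with rfl | hji
  · simp
  · simp [hji, eq_comm]

theorem hasMinorsIn_monomialMatrix_oneAddDeriv {u : R} (hu : u ∈ N) :
    HasMinorsIn N (monomialMatrix (oneAddDeriv u)) := by
  refine HasMinorsIn.transpose (M := (monomialMatrix (oneAddDeriv u)).transpose)
    (HasMinorsIn.of_bidiagonal (fun i j => ?_) fun i j hj hj' => ?_)
  · rw [Matrix.transpose_apply, monomialMatrix_oneAddDeriv]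
    split_ifs
    · exact N.one_mem
    · exact N.mul_mem hu (by exact_mod_cast natCast_mem N (i + 1))
    · exact N.zero_mem
  · rw [Matrix.transpose_apply, monomialMatrix_oneAddDeriv, if_neg hj.symm, if_neg hj']

end PolynomialOperators

section GenLahPoly

open Polynomial

variable {R : Type*} [CommRing R]

/-- The row-generating polynomial `T_n` of the generalized Lah triangle, defined by
`T_{n + 1} = a b (n + d) T_n + (X + l) (c T_n + b T_n')`. -/
noncomputable def genLahPoly (a : ℕ) (b c d l : R) : ℕ → R[X]
  | 0 => 1
  | n + 1 => C (a * b * (n + d)) * genLahPoly a b c d l n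
      + (X + C l) * (C c * genLahPoly a b c d l n + C b * derivative (genLahPoly a b c d l n))

theorem coeff_zero_genLahPoly_succ (a : ℕ) (b c d l : R) (n : ℕ) :
    (genLahPoly a b c d l (n + 1)).coeff 0
      = (a * b * n + a * b * d + c * l) * (genLahPoly a b c d l n).coeff 0
        + b * l * (genLahPoly a b c d l n).coeff 1 := by
  simp only [genLahPoly, coeff_add, coeff_C_mul, add_mul, coeff_X_mul_zero, coeff_derivative]
  push_cast
  ring

theorem coeff_succ_genLahPoly_succ (a : ℕ) (b c d l : R) (n k : ℕ) :
    (genLahPoly a b c d l (n + 1)).coeff (k + 1) = c * (genLahPoly a b c d l n).coeff k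
      + (a * b * n + b * ((k + 1 : ℕ) : R) + a * b * d + c * l)
        * (genLahPoly a b c d l n).coeff (k + 1)
      + b * l * ((k + 2 : ℕ) : R) * (genLahPoly a b c d l n).coeff (k + 2) := by
  simp only [genLahPoly, coeff_add, coeff_C_mul, add_mul, coeff_X_mul, coeff_derivative]
  push_cast
  ring

theorem coeff_genLahPoly_of_lt (a : ℕ) (b c d l : R) {n k : ℕ} (h : n < k) :
    (genLahPoly a b c d l n).coeff k = 0 := by
  induction n generalizing k with
  | zero => simp [genLahPoly, coeff_one, h.ne']
  | succ n ih =>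
    obtain ⟨k, rfl⟩ : ∃ j, k = j + 1 := ⟨k - 1, by omega⟩
    rw [coeff_succ_genLahPoly_succ, ih (by omega), ih (by omega), ih (by omega)]
    ring

theorem coeff_genLahPoly_self (a : ℕ) (b c d l : R) (n : ℕ) :
    (genLahPoly a b c d l n).coeff n = c ^ n := by
  induction n with
  | zero => simp [genLahPoly]
  | succ n ih =>
    rw [coeff_succ_genLahPoly_succ, ih, coeff_genLahPoly_of_lt a b c d l (by omega),
      coeff_genLahPoly_of_lt a b c d l (by omega)]
    ring

theorem coeff_genLahPoly_mem {N : Subsemiring R} (a : ℕ) {b c d l : R} (hb : b ∈ N) (hc : c ∈ N)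
    (hd : d ∈ N) (hl : l ∈ N) (n k : ℕ) : (genLahPoly a b c d l n).coeff k ∈ N := by
  have ha := natCast_mem N a
  induction n generalizing k with
  | zero =>
    rw [genLahPoly, coeff_one]
    split_ifs
    exacts [N.one_mem, N.zero_mem]
  | succ n ih =>
    have hab : (a * b * n + a * b * d + c * l : R) ∈ N :=
      N.add_mem (N.add_mem (N.mul_mem (N.mul_mem ha hb) (natCast_mem N n))
        (N.mul_mem (N.mul_mem ha hb) hd)) (N.mul_mem hc hl)
    have hbl : b * l ∈ N := N.mul_mem hb hl
    rcases k with _ | k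
    · rw [coeff_zero_genLahPoly_succ]
      exact N.add_mem (N.mul_mem hab (ih 0)) (N.mul_mem hbl (ih 1))
    · have hdiag : (a * b * n + b * ((k + 1 : ℕ) : R) + a * b * d + c * l) ∈ N := by
        convert N.add_mem hab (N.mul_mem hb (natCast_mem N (k + 1))) using 1
        ring
      rw [coeff_succ_genLahPoly_succ]
      exact N.add_mem (N.add_mem (N.mul_mem hc (ih k)) (N.mul_mem hdiag (ih (k + 1))))
        (N.mul_mem (N.mul_mem hbl (natCast_mem N (k + 2))) (ih (k + 2)))

theorem isGenLahTriangle_coeff_genLahPoly (a : ℕ) (b c d l : R) :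
    IsGenLahTriangle a b c d l fun n k => (genLahPoly a b c d l n).coeff k where
  init := by simp [genLahPoly]
  lower _ _ := coeff_genLahPoly_of_lt a b c d l
  rec_zero := coeff_zero_genLahPoly_succ a b c d l
  rec_succ := coeff_succ_genLahPoly_succ a b c d l

theorem genLahPoly_comp_X_add_C (a : ℕ) (b c d l q : R) (n : ℕ) :
    (genLahPoly a b c d l n).comp (X + C q) = genLahPoly a b c d (l + q) n := by
  induction n with
  | zero => simp [genLahPoly]
  | succ n ih =>
    have ih' := congrArg derivative ih
    simp only [derivative_comp, derivative_add, derivative_X, derivative_C, add_zero,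
      one_mul] at ih'
    simp only [genLahPoly, add_comp, mul_comp, C_comp, X_comp, ih, ih', C_add]
    ring

theorem eval_genLahPoly (a : ℕ) (b c d l q : R) (n : ℕ) :
    (genLahPoly a b c d l n).eval q = (genLahPoly a b c d (l + q) n).coeff 0 := by
  rw [← genLahPoly_comp_X_add_C, coeff_zero_eq_eval_zero, eval_comp]
  simp

namespace IsGenLahTriangle

variable {a : ℕ} {b c d l : R} {T T' : ℕ → ℕ → R}

theorem unique (hT : IsGenLahTriangle a b c d l T) (hT' : IsGenLahTriangle a b c d l T') :
    T = T' := by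
  suffices ∀ n k, T n k = T' n k from funext₂ this
  intro n
  induction n with
  | zero =>
    rintro (_ | k)
    · rw [hT.init, hT'.init]
    · rw [hT.lower 0 _ k.succ_pos, hT'.lower 0 _ k.succ_pos]
  | succ n ih =>
    rintro (_ | k)
    · rw [hT.rec_zero, hT'.rec_zero, ih, ih]
    · rw [hT.rec_succ, hT'.rec_succ, ih, ih, ih]

theorem eq_coeff (hT : IsGenLahTriangle a b c d l T) :
    T = fun n k => (genLahPoly a b c d l n).coeff k :=
  hT.unique (isGenLahTriangle_coeff_genLahPoly a b c d l)

theorem rowPoly_eq (hT : IsGenLahTriangle a b c d l T) : rowPoly T = genLahPoly a b c d l := by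
  ext n k
  rw [rowPoly, finsetSum_coeff, hT.eq_coeff]
  simp only [coeff_C_mul_X_pow, sum_ite_eq, mem_range, ite_eq_left_iff]
  intro hk
  exact (coeff_genLahPoly_of_lt a b c d l (by omega)).symm

theorem eval_zero_rowPoly (hT : IsGenLahTriangle a b c d l T) (n : ℕ) :
    (rowPoly T n).eval 0 = T n 0 := by
  rw [← coeff_zero_eq_eval_zero, hT.rowPoly_eq, hT.eq_coeff]

end IsGenLahTriangle

end GenLahPoly

section ProductionOperator

open Polynomial

variable {R : Type*} [CommRing R]

/-- The operator `c (X + l) (1 + u d/dX)`; with `b = u c` the recurrence of `genLahPoly` reads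
`T_{n + 1} = (a b (n + d) + eulerOp) T_n`. -/
noncomputable def eulerOp (u c l : R) : Module.End R R[X] :=
  LinearMap.mulLeft R (C c * (X + C l)) * oneAddDeriv u

/-- The production operator of the generalized Lah triangle with `b = u c`: it maps the polynomial
of each row to the polynomial of the next one. -/
noncomputable def lahProductionOp (a : ℕ) (u c d l : R) : Module.End R R[X] :=
  (algebraMap R _ (a * (u * c) * d) + eulerOp u c l) * oneAddDeriv u ^ a

theorem eulerOp_apply (u c l : R) (p : R[X]) :
    eulerOp u c l p = C c * (X + C l) * (p + C u * derivative p) := by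
  rw [eulerOp, Module.End.mul_apply, oneAddDeriv_apply, LinearMap.mulLeft_apply]

theorem oneAddDeriv_mul_eulerOp (u c l : R) :
    oneAddDeriv u * eulerOp u c l
      = (eulerOp u c l + algebraMap R _ (u * c)) * oneAddDeriv u := by
  refine LinearMap.ext fun p => ?_
  simp only [Module.End.mul_apply, LinearMap.add_apply, Module.algebraMap_end_apply,
    oneAddDeriv_apply, eulerOp_apply, derivative_mul, derivative_C, derivative_add, derivative_X,
    smul_eq_C_mul, C_mul]
  ring

theorem oneAddDeriv_pow_mul_eulerOp (u c l : R) (n : ℕ) :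
    oneAddDeriv u ^ n * eulerOp u c l
      = (eulerOp u c l + algebraMap R _ (n * (u * c))) * oneAddDeriv u ^ n := by
  induction n with
  | zero => simp
  | succ n ih =>
    have hcomm := Algebra.commutes (A := Module.End R R[X]) (n * (u * c)) (oneAddDeriv u)
    calc oneAddDeriv u ^ (n + 1) * eulerOp u c l
        = (oneAddDeriv u * eulerOp u c l + oneAddDeriv u * algebraMap R _ (n * (u * c)))
            * oneAddDeriv u ^ n := by rw [pow_succ', mul_assoc, ih, ← mul_assoc, mul_add]
      _ = (eulerOp u c l + algebraMap R _ ((n + 1 : ℕ) * (u * c))) * oneAddDeriv u ^ (n + 1) := by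
          rw [oneAddDeriv_mul_eulerOp, ← hcomm, ← add_mul, mul_assoc, ← pow_succ', add_assoc,
            ← map_add, Nat.cast_succ]
          ring_nf

theorem lahProductionOp_mul (a : ℕ) (u c d l x : R) :
    lahProductionOp a u c d l * (algebraMap R _ x + eulerOp u c l)
      = (algebraMap R _ (x + a * (u * c)) + eulerOp u c l) * lahProductionOp a u c d l := by
  have hpow : oneAddDeriv u ^ a * (algebraMap R _ x + eulerOp u c l)
      = (algebraMap R _ (x + a * (u * c)) + eulerOp u c l) * oneAddDeriv u ^ a := by
    rw [mul_add, ← Algebra.commutes, oneAddDeriv_pow_mul_eulerOp, ← add_mul, map_add,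
      add_assoc, add_comm (algebraMap R _ (a * (u * c)))]
  have hcomm : Commute (algebraMap R (Module.End R R[X]) (a * (u * c) * d) + eulerOp u c l)
      (algebraMap R _ (x + a * (u * c)) + eulerOp u c l) :=
    (Algebra.commute_algebraMap_left _ _).add_left
      ((Algebra.commute_algebraMap_right _ _).add_right (Commute.refl _))
  rw [lahProductionOp, mul_assoc, hpow, ← mul_assoc, hcomm.eq, mul_assoc]

theorem genLahPoly_succ_eq_add_eulerOp (a : ℕ) (u c d l : R) (n : ℕ) :
    genLahPoly a (u * c) c d l (n + 1)
      = (algebraMap R _ (a * (u * c) * (n + d)) + eulerOp u c l)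
          (genLahPoly a (u * c) c d l n) := by
  simp only [genLahPoly, LinearMap.add_apply, Module.algebraMap_end_apply, eulerOp_apply,
    smul_eq_C_mul, C_mul]
  ring

theorem genLahPoly_succ_eq_lahProductionOp (a : ℕ) (u c d l : R) (n : ℕ) :
    genLahPoly a (u * c) c d l (n + 1)
      = lahProductionOp a u c d l (genLahPoly a (u * c) c d l n) := by
  induction n with
  | zero =>
    rw [genLahPoly_succ_eq_add_eulerOp, lahProductionOp, Module.End.mul_apply]
    simp [genLahPoly, oneAddDeriv_pow_apply_one]
  | succ n ih =>
    have hcast : (a * (u * c) * ((n + 1 : ℕ) + d) : R) = a * (u * c) * (n + d) + a * (u * c) := by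
      push_cast
      ring
    rw [genLahPoly_succ_eq_add_eulerOp, hcast, ih, ← Module.End.mul_apply, ← lahProductionOp_mul,
      Module.End.mul_apply, ← genLahPoly_succ_eq_add_eulerOp, ih]

theorem genLahPoly_eq_lahProductionOp_pow (a : ℕ) (u c d l : R) (n : ℕ) :
    genLahPoly a (u * c) c d l n = (lahProductionOp a u c d l ^ n) 1 := by
  induction n with
  | zero => simp [genLahPoly]
  | succ n ih => rw [genLahPoly_succ_eq_lahProductionOp, ih, pow_succ', Module.End.mul_apply]

variable {N : Subsemiring R}

theorem monomialMatrix_eulerOp_eq_zero (u c l : R) {i j : ℕ} (hij : i + 1 < j ∨ j + 1 < i) :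
    monomialMatrix (eulerOp u c l) i j = 0 := by
  have hentry : ∀ k, k + 1 < i ∨ i < k → (oneAddDeriv u (X ^ i)).coeff k = 0 := fun k hk =>
    (monomialMatrix_oneAddDeriv u i k).trans (by rw [if_neg (by omega), if_neg (by omega)])
  rw [monomialMatrix, Matrix.of_apply, eulerOp, Module.End.mul_apply, LinearMap.mulLeft_apply,
    mul_assoc, coeff_C_mul, add_mul, coeff_add, coeff_C_mul, hentry j (by omega)]
  rcases j with _ | j
  · simp
  · simp [coeff_X_mul, hentry j (by omega)]

theorem hasMinorsIn_monomialMatrix_eulerOp {u c l : R} (hu : u ∈ N) (hc : c ∈ N) (hl : l ∈ N) :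
    HasMinorsIn N (monomialMatrix (eulerOp u c l)) := by
  rw [eulerOp, mul_add, ← C_mul]
  exact (hasMinorsIn_monomialMatrix_oneAddDeriv hu).monomialMatrix_mul
    (hasMinorsIn_monomialMatrix_mulLeft_linear hc (N.mul_mem hc hl))

theorem hasMinorsIn_monomialMatrix_lahProductionOp (a : ℕ) {u c d l : R} (hu : u ∈ N) (hc : c ∈ N)
    (hd : d ∈ N) (hl : l ∈ N) : HasMinorsIn N (monomialMatrix (lahProductionOp a u c d l)) := by
  have hβ : (a * (u * c) * d : R) ∈ N :=
    N.mul_mem (N.mul_mem (natCast_mem N a) (N.mul_mem hu hc)) hd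
  refine ((hasMinorsIn_monomialMatrix_oneAddDeriv hu).monomialMatrix_pow a).monomialMatrix_mul ?_
  convert (hasMinorsIn_monomialMatrix_eulerOp hu hc hl).add_diagonal
    (fun i j => monomialMatrix_eulerOp_eq_zero u c l) (fun _ => hβ) using 1
  ext i j
  rcases eq_or_ne i j with rfl | hij
  · simp only [monomialMatrix, Matrix.of_apply, Matrix.add_apply, Matrix.diagonal_apply_eq,
      LinearMap.add_apply, Module.algebraMap_end_apply, coeff_add, coeff_smul, coeff_X_pow_self,
      smul_eq_mul, mul_one, add_comm]
  · simp [monomialMatrix, coeff_X_pow, hij, hij.symm]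

theorem hasMinorsIn_coeff_genLahPoly (a : ℕ) {u c d l : R} (hu : u ∈ N) (hc : c ∈ N)
    (hd : d ∈ N) (hl : l ∈ N) :
    HasMinorsIn N (Matrix.of fun n k => (genLahPoly a (u * c) c d l n).coeff k) := by
  simpa only [genLahPoly_eq_lahProductionOp_pow] using
    hasMinorsIn_coeff_pow_apply_one (hasMinorsIn_monomialMatrix_lahProductionOp a hu hc hd hl)

theorem hasMinorsIn_hankel_eval_genLahPoly (a : ℕ) {u c d l q : R} (hu : u ∈ N) (hc : c ∈ N)
    (hd : d ∈ N) (hl : l ∈ N) (hq : q ∈ N) :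
    HasMinorsIn N (Matrix.of fun i j => (genLahPoly a (u * c) c d l (i + j)).eval q) := by
  simp only [eval_genLahPoly]
  simpa only [genLahPoly_eq_lahProductionOp_pow] using
    hasMinorsIn_hankel_pow_apply_one
      (hasMinorsIn_monomialMatrix_lahProductionOp a hu hc hd (N.add_mem hl hq))

end ProductionOperator

section LogConvex

variable {R : Type*} [CommRing R] {N : Subsemiring R}

/-- The Hankel determinant `det (α (i + s + t))` of size `r`. -/
def hankelDet (α : ℕ → R) (r i : ℕ) : R :=
  (Matrix.of fun s t : Fin r => α (i + s + t)).det

theorem hankelDet_two (α : ℕ → R) (i : ℕ) : hankelDet α 2 i = logConvexOp α i := by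
  simp only [hankelDet, logConvexOp, Matrix.det_fin_two, Matrix.of_apply, Fin.val_zero, Fin.val_one,
    add_assoc, add_zero, zero_add, Nat.reduceAdd]
  ring

theorem hankelDet_three (α : ℕ → R) (i : ℕ) :
    hankelDet α 3 i = α i * (α (i + 2) * α (i + 4) - α (i + 3) ^ 2)
      - α (i + 1) * (α (i + 1) * α (i + 4) - α (i + 2) * α (i + 3))
      + α (i + 2) * (α (i + 1) * α (i + 3) - α (i + 2) ^ 2) := by
  simp only [hankelDet, Matrix.det_fin_three, Matrix.of_apply, Fin.val_zero, Fin.val_one,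
    Fin.val_two, add_assoc, add_zero, zero_add, Nat.reduceAdd]
  ring

theorem hankelDet_mul_hankelDet (α : ℕ → R) (i : ℕ) :
    hankelDet α 4 i * hankelDet α 2 (i + 2)
      = hankelDet α 3 i * hankelDet α 3 (i + 2) - hankelDet α 3 (i + 1) ^ 2 := by
  rw [hankelDet_two, hankelDet_three, hankelDet_three, hankelDet_three, hankelDet, logConvexOp]
  simp only [Matrix.det_succ_row_zero, Fin.sum_univ_succ, Matrix.of_apply]
  simp [Fin.succAbove, add_assoc]
  ring

theorem logConvexOp_iterate_two (α : ℕ → R) (i : ℕ) :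
    logConvexOp^[2] α i = α (i + 2) * hankelDet α 3 i := by
  simp only [Function.iterate_succ, Function.iterate_zero, Function.comp_apply, id, logConvexOp,
    hankelDet_three, add_assoc, Nat.reduceAdd]
  ring

theorem logConvexOp_iterate_three (α : ℕ → R) (i : ℕ) :
    logConvexOp^[3] α i = α (i + 2) * α (i + 4) * (hankelDet α 4 i * hankelDet α 2 (i + 2))
      + hankelDet α 2 (i + 2) * hankelDet α 3 (i + 1) ^ 2 := by
  rw [hankelDet_mul_hankelDet, Function.iterate_succ_apply', logConvexOp, hankelDet_two,
    logConvexOp_iterate_two, logConvexOp_iterate_two, logConvexOp_iterate_two, logConvexOp]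
  ring

theorem HasMinorsIn.hankelDet_mem {α : ℕ → R}
    (h : HasMinorsIn N (Matrix.of fun i j => α (i + j))) (r i : ℕ) : hankelDet α r i ∈ N :=
  h r (fun s => i + s) (fun t => t) (fun _ _ hst => Nat.add_lt_add_left hst i) fun _ _ hst => hst

theorem HasMinorsIn.logConvexOp_iterate_mem {α : ℕ → R}
    (h : HasMinorsIn N (Matrix.of fun i j => α (i + j))) {m : ℕ} (hm : m ≤ 3) (i : ℕ) :
    logConvexOp^[m] α i ∈ N := by
  have hα : ∀ i, α i ∈ N := fun i => h.apply_mem i 0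
  interval_cases m
  · exact hα i
  · simpa only [Function.iterate_one, hankelDet_two] using h.hankelDet_mem 2 i
  · exact logConvexOp_iterate_two α i ▸ N.mul_mem (hα _) (h.hankelDet_mem 3 i)
  · rw [logConvexOp_iterate_three]
    exact N.add_mem (N.mul_mem (N.mul_mem (hα _) (hα _))
        (N.mul_mem (h.hankelDet_mem 4 i) (h.hankelDet_mem 2 _)))
      (N.mul_mem (h.hankelDet_mem 2 _) (N.pow_mem (h.hankelDet_mem 3 _) 2))

end LogConvex

section NonnegativeCoefficients

variable {σ : Type*}

/-- The subsemiring of polynomials with nonnegative coefficients; `IsXTP` is `HasMinorsIn` for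
it. -/
def nonnegCoeffs (σ : Type*) : Subsemiring (MvPolynomial σ ℝ) where
  carrier := {p | NonnegCoeffs p}
  zero_mem' _ := by simp
  one_mem' e := by
    classical
    rw [MvPolynomial.coeff_one]
    split_ifs
    exacts [zero_le_one, le_rfl]
  add_mem' hp hq e := by
    rw [MvPolynomial.coeff_add]
    exact add_nonneg (hp e) (hq e)
  mul_mem' hp hq e := by
    classical
    rw [MvPolynomial.coeff_mul]
    exact sum_nonneg fun _ _ => mul_nonneg (hp _) (hq _)

theorem X_mem_nonnegCoeffs (s : σ) : MvPolynomial.X s ∈ nonnegCoeffs σ := by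
  classical
  intro e
  rw [MvPolynomial.coeff_X]
  split_ifs
  exacts [zero_le_one, le_rfl]

theorem C_mem_nonnegCoeffs {r : ℝ} (hr : 0 ≤ r) : MvPolynomial.C r ∈ nonnegCoeffs σ := by
  classical
  intro e
  rw [MvPolynomial.coeff_C]
  split_ifs
  exacts [hr, le_rfl]

end NonnegativeCoefficients

section ExplicitFormula

open Polynomial

variable {R : Type*} [CommRing R]

/-- The linear functional `X ^ j ↦ x (x - 1) ⋯ (x - j + 1)` on polynomials. -/
noncomputable def descFactorialFunctional (R : Type*) [CommRing R] (x : ℕ) : R[X] →ₗ[R] R :=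
  lsum fun j => (x.descFactorial j : R) • LinearMap.id

theorem descFactorialFunctional_monomial (x j : ℕ) (r : R) :
    descFactorialFunctional R x (monomial j r) = x.descFactorial j * r := by
  rw [descFactorialFunctional, lsum_apply, sum_monomial_index _ _ (by simp)]
  simp

theorem cast_descFactorial_succ (x j : ℕ) :
    (x.descFactorial (j + 1) : R) = (x - j) * x.descFactorial j := by
  rw [Nat.descFactorial_succ, Nat.cast_mul]
  rcases le_or_gt j x with h | h
  · rw [Nat.cast_sub h]
  · simp [Nat.descFactorial_eq_zero_iff_lt.2 h]

theorem descFactorialFunctional_X_mul_add_derivative (x : ℕ) (p : R[X]) :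
    descFactorialFunctional R x (X * (p + derivative p)) = x * descFactorialFunctional R x p := by
  induction p using Polynomial.induction_on' with
  | add p q hp hq =>
    have hadd : X * (p + q + derivative (p + q))
        = X * (p + derivative p) + X * (q + derivative q) := by
      rw [derivative_add]
      ring
    rw [hadd, map_add, map_add, hp, hq, mul_add]
  | monomial j r =>
    have hmonomial : X * (monomial j r + derivative (monomial j r))
        = monomial (j + 1) r + monomial j (j * r) := by
      rw [mul_add, X_mul_monomial, derivative_monomial]
      rcases j with _ | j
      · simp
      · rw [X_mul_monomial, Nat.add_sub_cancel, mul_comm r]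
    rw [hmonomial, map_add]
    simp only [descFactorialFunctional_monomial, cast_descFactorial_succ]
    ring

theorem descFactorialFunctional_genLahPoly (a : ℕ) (b d : R) (n x : ℕ) :
    descFactorialFunctional R x (genLahPoly a b b d 0 n)
      = ∏ r ∈ range n, b * (x + a * r + a * d) := by
  induction n with
  | zero =>
    rw [genLahPoly, ← monomial_zero_one, descFactorialFunctional_monomial]
    simp
  | succ n ih =>
    have hsucc : genLahPoly a b b d 0 (n + 1) = (a * b * (n + d)) • genLahPoly a b b d 0 n
        + b • (X * (genLahPoly a b b d 0 n + derivative (genLahPoly a b b d 0 n))) := by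
      rw [genLahPoly, smul_eq_C_mul, smul_eq_C_mul, C_0]
      ring
    rw [hsucc, map_add, map_smul, map_smul, descFactorialFunctional_X_mul_add_derivative, ih,
      prod_range_succ, smul_eq_mul, smul_eq_mul]
    ring

theorem natDegree_genLahPoly_le (a : ℕ) (b c d l : R) (n : ℕ) :
    (genLahPoly a b c d l n).natDegree ≤ n :=
  natDegree_le_iff_coeff_eq_zero.2 fun _ => coeff_genLahPoly_of_lt a b c d l

theorem sum_coeff_genLahPoly_mul_descFactorial (a : ℕ) (b d : R) (n x : ℕ) {K : ℕ} (hK : n < K) :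
    ∑ j ∈ range K, (genLahPoly a b b d 0 n).coeff j * x.descFactorial j
      = ∏ r ∈ range n, b * (x + a * r + a * d) := by
  rw [← descFactorialFunctional_genLahPoly,
    (genLahPoly a b b d 0 n).as_sum_range' K ((natDegree_genLahPoly_le a b b d 0 n).trans_lt hK),
    map_sum, ← (genLahPoly a b b d 0 n).as_sum_range' K
      ((natDegree_genLahPoly_le a b b d 0 n).trans_lt hK)]
  exact sum_congr rfl fun j _ => by rw [descFactorialFunctional_monomial, mul_comm]

theorem sum_neg_one_pow_mul_choose_mul_choose (m n : ℕ) :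
    ∑ i ∈ range (n + 1), (-1 : R) ^ (n - i) * n.choose i * i.choose m = if n = m then 1 else 0 := by
  have h := fwdDiff_iter_choose_zero m n
  rw [fwdDiff_iter_eq_sum_shift] at h
  simpa using congrArg (Int.cast : ℤ → R) h

theorem factorial_mul_coeff_genLahPoly (a : ℕ) (b d : R) (n k : ℕ) :
    k.factorial * (genLahPoly a b b d 0 n).coeff k
      = ∑ i ∈ range (k + 1), (-1) ^ (k - i) * k.choose i
          * ∏ r ∈ range n, b * (i + a * r + a * d) := by
  set t := (genLahPoly a b b d 0 n).coeff
  have hprod : ∀ i : ℕ, ∏ r ∈ range n, b * (i + a * r + a * d)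
      = ∑ j ∈ range (n + k + 1), t j * (j.factorial * i.choose j) := fun i => by
    rw [← sum_coeff_genLahPoly_mul_descFactorial a b d n i (show n < n + k + 1 by omega)]
    simp only [Nat.descFactorial_eq_factorial_mul_choose, Nat.cast_mul, t]
  calc k.factorial * t k
      = ∑ j ∈ range (n + k + 1), j.factorial * t j * if k = j then 1 else 0 := by
        simp only [mul_ite, mul_one, mul_zero]
        rw [sum_ite_eq, if_pos (mem_range.2 (by omega))]
    _ = ∑ j ∈ range (n + k + 1), j.factorial * t j
          * ∑ i ∈ range (k + 1), (-1 : R) ^ (k - i) * k.choose i * i.choose j := by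
        simp only [sum_neg_one_pow_mul_choose_mul_choose]
    _ = _ := by
        simp only [hprod, mul_sum]
        rw [sum_comm]
        exact sum_congr rfl fun i _ => sum_congr rfl fun j _ => by ring

theorem coeff_genLahPoly_eq_pow_mul (a : ℕ) (b c d : R) {n j : ℕ} (hj : j ≤ n) :
    (genLahPoly a b c d 0 n).coeff j
      = b ^ (n - j) * c ^ j * (genLahPoly a 1 1 d 0 n).coeff j := by
  induction n generalizing j with
  | zero =>
    obtain rfl : j = 0 := by omega
    simp [genLahPoly]
  | succ n ih =>
    rcases j with _ | j
    · rw [coeff_zero_genLahPoly_succ, coeff_zero_genLahPoly_succ, ih n.zero_le, Nat.sub_zero,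
        Nat.sub_zero]
      ring
    · rw [coeff_succ_genLahPoly_succ, coeff_succ_genLahPoly_succ, ih (by omega : j ≤ n),
        Nat.add_sub_add_right]
      rcases Nat.lt_or_ge j n with h | h
      · rw [ih (show j + 1 ≤ n from h), (by omega : n - j = n - (j + 1) + 1)]
        ring
      · simp only [coeff_genLahPoly_of_lt _ _ _ _ _ (show n < j + 1 by omega)]
        ring

theorem coeff_genLahPoly_eq_sum (a : ℕ) (b c d l : R) {n K : ℕ} (hK : n < K) (k : ℕ) :
    (genLahPoly a b c d l n).coeff k = ∑ m ∈ range K,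
      m.choose k * l ^ (m - k) * (genLahPoly a b c d 0 n).coeff m := by
  have hcomp := congrArg (fun p => (p.comp (X + C l)).coeff k)
    ((genLahPoly a b c d 0 n).as_sum_range' K ((natDegree_genLahPoly_le a b c d 0 n).trans_lt hK))
  simp only [genLahPoly_comp_X_add_C, zero_add, Polynomial.sum_comp, monomial_comp, finsetSum_coeff,
    coeff_C_mul, coeff_X_add_C_pow] at hcomp
  rw [hcomp]
  exact sum_congr rfl fun m _ => by ring

theorem sum_coeff_genLahPoly_mul_pow_mul_pow (a : ℕ) (b c d l s r : R) (n : ℕ) :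
    ∑ k ∈ range (n + 1), (genLahPoly a b c d l n).coeff k * s ^ k * r ^ (n - k)
      = ∑ m ∈ range (n + 1),
          (genLahPoly a 1 1 d 0 n).coeff m * (c * (s + l * r)) ^ m * (b * r) ^ (n - m) := by
  have hbinom : ∀ m ∈ range (n + 1),
      ∑ k ∈ range (n + 1), m.choose k * l ^ (m - k) * s ^ k * r ^ (n - k)
        = (s + l * r) ^ m * r ^ (n - m) := fun m hm => by
    rw [mem_range] at hm
    rw [add_pow, sum_mul, ← sum_subset (range_mono (show m + 1 ≤ n + 1 by omega))
      fun k _ hk => by simp [Nat.choose_eq_zero_of_lt (not_lt.1 (mem_range.not.1 hk))]]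
    refine sum_congr rfl fun k hk => ?_
    rw [mem_range] at hk
    rw [(by omega : n - k = (m - k) + (n - m)), pow_add, mul_pow]
    ring
  simp only [coeff_genLahPoly_eq_sum a b c d l n.lt_succ_self, sum_mul]
  rw [sum_comm]
  refine sum_congr rfl fun m hm => ?_
  rw [coeff_genLahPoly_eq_pow_mul a b c d (Nat.lt_succ_iff.1 (mem_range.1 hm)), mul_pow, mul_pow]
  have hscaled :=
    congrArg (b ^ (n - m) * c ^ m * (genLahPoly a 1 1 d 0 n).coeff m * ·) (hbinom m hm)
  simp only [mul_sum] at hscaled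
  exact (sum_congr rfl fun k _ => by ring).trans (hscaled.trans (by ring))

variable {K : Type*} [Field K]

theorem explicit_term_eq [CharZero K] (a : ℕ) (b c d l : K) (n k j : ℕ) :
    1 / (k.factorial : K) * ∑ i ∈ range (k + j + 1),
        (-1) ^ ((n : ℤ) + k + j - i) * b ^ ((n : ℤ) - k - j) * c ^ (k + j) * l ^ j
          / j.factorial * (k + j).choose i * ∏ r ∈ range n, (-(i + a * d) - r * a)
      = b ^ ((n : ℤ) - k - j) * c ^ (k + j) * l ^ j * (k + j).choose k
          * (genLahPoly a 1 1 d 0 n).coeff (k + j) := by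
  have hsummand : ∀ i ∈ range (k + j + 1),
      (-1) ^ ((n : ℤ) + k + j - i) * b ^ ((n : ℤ) - k - j) * c ^ (k + j) * l ^ j
          / j.factorial * (k + j).choose i * ∏ r ∈ range n, (-(i + a * d) - r * a)
        = b ^ ((n : ℤ) - k - j) * c ^ (k + j) * l ^ j / j.factorial
          * ((-1) ^ (k + j - i) * (k + j).choose i
            * ∏ r ∈ range n, (1 : K) * (i + a * r + a * d)) := fun i hi => by
    have hexp : (n : ℤ) + k + j - i = (n + (k + j - i) : ℕ) := by
      push_cast [Nat.cast_sub (mem_range_succ_iff.1 hi)]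
      ring
    have hneg : ∏ r ∈ range n, (-(i + a * d) - r * a : K)
        = (-1) ^ n * ∏ r ∈ range n, (1 : K) * (i + a * r + a * d) := by
      rw [← card_range n, ← prod_const, card_range, ← prod_mul_distrib]
      exact prod_congr rfl fun r _ => by ring
    have hsq : (-1 : K) ^ n * (-1) ^ n = 1 := by rw [← mul_pow, neg_one_mul, neg_neg, one_pow]
    rw [hexp, zpow_natCast, pow_add, hneg]
    linear_combination (b ^ ((n : ℤ) - k - j) * c ^ (k + j) * l ^ j / (j.factorial : K)
      * (-1) ^ (k + j - i) * (k + j).choose i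
      * ∏ r ∈ range n, (1 : K) * (i + a * r + a * d)) * hsq
  have hfac : ((k + j).factorial : K) = (k + j).choose k * k.factorial * j.factorial := by
    rw [← Nat.add_choose_mul_factorial_mul_factorial k j, ← Nat.choose_symm_add]
    push_cast
    rfl
  have hk : (k.factorial : K) ≠ 0 := Nat.cast_ne_zero.2 k.factorial_ne_zero
  have hj : (j.factorial : K) ≠ 0 := Nat.cast_ne_zero.2 j.factorial_ne_zero
  rw [sum_congr rfl hsummand, ← mul_sum, ← factorial_mul_coeff_genLahPoly, hfac]
  field_simp

theorem hasSum_coeff_genLahPoly [CharZero K] [TopologicalSpace K] (a : ℕ) (b c d l : K)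
    (n k : ℕ) :
    HasSum (fun j : ℕ => 1 / (k.factorial : K) * ∑ i ∈ range (k + j + 1),
        (-1) ^ ((n : ℤ) + k + j - i) * b ^ ((n : ℤ) - k - j) * c ^ (k + j) * l ^ j
          / j.factorial * (k + j).choose i * ∏ r ∈ range n, (-(i + a * d) - r * a))
      ((genLahPoly a b c d l n).coeff k) := by
  have hsum : (genLahPoly a b c d l n).coeff k = ∑ j ∈ range (n + 1),
      b ^ ((n : ℤ) - k - j) * c ^ (k + j) * l ^ j * (k + j).choose k
        * (genLahPoly a 1 1 d 0 n).coeff (k + j) := by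
    rw [coeff_genLahPoly_eq_sum a b c d l (show n < k + (n + 1) by omega), sum_range_add,
      sum_eq_zero fun m hm => by simp [Nat.choose_eq_zero_of_lt (mem_range.1 hm)], zero_add]
    refine sum_congr rfl fun j _ => ?_
    rcases Nat.lt_or_ge n (k + j) with h | h
    · simp only [coeff_genLahPoly_of_lt _ _ _ _ _ h, mul_zero]
    · have hexp : (n : ℤ) - k - j = (n - (k + j) : ℕ) := by
        push_cast [Nat.cast_sub h]
        ring
      rw [coeff_genLahPoly_eq_pow_mul a b c d h, hexp, zpow_natCast, Nat.add_sub_cancel_left]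
      ring
  simp only [explicit_term_eq]
  rw [hsum]
  refine hasSum_sum_of_ne_finset_zero fun j hj => ?_
  rw [mem_range] at hj
  rw [coeff_genLahPoly_of_lt _ _ _ _ _ (by omega), mul_zero]

theorem prod_neg_add_sub_mul_eq_descPochhammer {a : ℕ} (ha : (a : K) ≠ 0) (x : K) (n : ℕ) :
    ∏ r ∈ range n, (-x - r * a) = a ^ n * (descPochhammer K n).eval (-(x / a)) := by
  rw [descPochhammer_eval_eq_prod_range, ← card_range n, ← prod_const, card_range,
    ← prod_mul_distrib]
  refine prod_congr rfl fun r _ => ?_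
  field_simp

end ExplicitFormula

section StieltjesMoments

open MeasureTheory ProbabilityTheory
open scoped NNReal ENNReal ProbabilityTheory

theorem isStieltjesMoment_of_lintegral {α : ℕ → ℝ} (hα : ∀ n, 0 ≤ α n) (μ : Measure ℝ≥0)
    (hμ : ∀ n : ℕ, ∫⁻ x, (x : ℝ≥0∞) ^ n ∂μ = ENNReal.ofReal (α n)) : IsStieltjesMoment α := by
  have hcoe : Measurable ((↑) : ℝ≥0 → ℝ) := measurable_coe_nnreal_real
  have hlintegral : ∀ n : ℕ, ∫⁻ x : ℝ, ENNReal.ofReal (x ^ n) ∂(μ.map ((↑) : ℝ≥0 → ℝ))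
      = ENNReal.ofReal (α n) := fun n => by
    rw [lintegral_map (by fun_prop) hcoe, ← hμ]
    refine lintegral_congr fun x => ?_
    rw [ENNReal.ofReal_pow x.coe_nonneg, ENNReal.ofReal_coe_nnreal]
  have hnonneg : ∀ n : ℕ, 0 ≤ᵐ[μ.map ((↑) : ℝ≥0 → ℝ)] fun x : ℝ => x ^ n := fun n =>
    Filter.Eventually.mono ((ae_map_iff hcoe.aemeasurable measurableSet_Ici).2
      (Filter.Eventually.of_forall fun x => x.2)) fun x hx => pow_nonneg hx n
  refine ⟨μ.map (↑), ?_, fun n => ⟨⟨by fun_prop, ?_⟩, ?_⟩⟩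
  · rw [Measure.map_apply hcoe measurableSet_Iio]
    convert measure_empty (μ := μ)
    ext x
    simp
  · rw [hasFiniteIntegral_iff_ofReal (hnonneg n), hlintegral]
    exact ENNReal.ofReal_lt_top
  · rw [integral_eq_lintegral_of_nonneg_ae (hnonneg n) (by fun_prop), hlintegral,
      ENNReal.toReal_ofReal (hα n)]

theorem IsStieltjesMoment.nonneg {α : ℕ → ℝ} (h : IsStieltjesMoment α) (n : ℕ) : 0 ≤ α n := by
  obtain ⟨μ, hsupp, hμ⟩ := h
  rw [(hμ n).2]
  exact integral_nonneg_of_ae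
    ((measure_eq_zero_iff_ae_notMem.1 hsupp).mono fun x hx => pow_nonneg (not_lt.1 hx) n)

theorem IsStieltjesMoment.exists_lintegral {α : ℕ → ℝ} (h : IsStieltjesMoment α) :
    ∃ μ : Measure ℝ≥0, IsFiniteMeasure μ ∧
      ∀ n : ℕ, ∫⁻ x, (x : ℝ≥0∞) ^ n ∂μ = ENNReal.ofReal (α n) := by
  obtain ⟨μ, hsupp, hμ⟩ := h
  have hnonneg : ∀ᵐ x ∂μ, 0 ≤ x :=
    (measure_eq_zero_iff_ae_notMem.1 hsupp).mono fun x hx => not_lt.1 hx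
  have hmoment : ∀ n : ℕ,
      ∫⁻ x, (x : ℝ≥0∞) ^ n ∂(μ.map Real.toNNReal) = ENNReal.ofReal (α n) := fun n => by
    rw [lintegral_map (by fun_prop) measurable_real_toNNReal, (hμ n).2,
      ofReal_integral_eq_lintegral_ofReal (hμ n).1 (hnonneg.mono fun x hx => pow_nonneg hx n)]
    exact lintegral_congr_ae (hnonneg.mono fun x hx => (ENNReal.ofReal_pow hx n).symm)
  refine ⟨μ.map Real.toNNReal, ⟨?_⟩, hmoment⟩
  have hmass := hmoment 0
  simp only [pow_zero, lintegral_one] at hmass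
  exact hmass ▸ ENNReal.ofReal_lt_top

theorem Gamma_add_nat_eq_prod {s : ℝ} (hs : 0 < s) (n : ℕ) :
    Real.Gamma (s + n) = Real.Gamma s * ∏ i ∈ range n, (s + i) := by
  induction n with
  | zero => simp
  | succ n ih =>
    rw [Nat.cast_succ, ← add_assoc, Real.Gamma_add_one (by positivity), ih, prod_range_succ]
    ring

theorem lintegral_ofReal_pow_gammaMeasure {s r : ℝ} (hs : 0 < s) (hr : 0 < r) (n : ℕ) :
    ∫⁻ x, ENNReal.ofReal x ^ n ∂gammaMeasure s r
      = ENNReal.ofReal (∏ i ∈ range n, (s + i) / r) := by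
  have := Real.Gamma_pos_of_pos hs
  have hshift : ∀ x, gammaPDF s r x * ENNReal.ofReal x ^ n
      = ENNReal.ofReal (∏ i ∈ range n, (s + i) / r) * gammaPDF (s + n) r x := fun x => by
    rcases lt_or_ge x 0 with hx | hx
    · rw [gammaPDF_of_neg hx, gammaPDF_of_neg hx, zero_mul, mul_zero]
    · rw [gammaPDF_of_nonneg hx, gammaPDF_of_nonneg hx, ← ENNReal.ofReal_pow hx,
        ← ENNReal.ofReal_mul (by positivity), ← ENNReal.ofReal_mul (by positivity),
        Gamma_add_nat_eq_prod hs, Real.rpow_add hr, Real.rpow_natCast, prod_div_distrib, prod_const,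
        card_range]
      congr 1
      have hprod : ∏ i ∈ range n, (s + i) ≠ 0 := prod_ne_zero_iff.2 fun i _ => by positivity
      have hpow : x ^ (s + n - 1) = x ^ (s - 1) * x ^ n := by
        rcases n.eq_zero_or_pos with rfl | hn
        · simp
        · have hn' : (1 : ℝ) ≤ n := by exact_mod_cast hn
          rw [← Real.rpow_add_natCast' hx (by linarith), sub_add_eq_add_sub]
      rw [hpow]
      field_simp
  have hmeas : ∀ s, Measurable (gammaPDF s r) := fun s =>
    (measurable_gammaPDFReal s r).ennreal_ofReal
  rw [gammaMeasure, lintegral_withDensity_eq_lintegral_mul _ (hmeas s) (by fun_prop)]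
  simp only [Pi.mul_apply, hshift]
  rw [lintegral_const_mul _ (hmeas (s + n)), lintegral_gammaPDF_eq_one (by positivity) hr, mul_one]

theorem exists_lintegral_pow_eq_prod {h a : ℝ} (hh : 0 ≤ h) (ha : 0 ≤ a) :
    ∃ γ : Measure ℝ≥0, IsProbabilityMeasure γ ∧
      ∀ n : ℕ, ∫⁻ x, (x : ℝ≥0∞) ^ n ∂γ = ENNReal.ofReal (∏ i ∈ range n, (h + a * i)) := by
  rcases ha.eq_or_lt with rfl | ha
  · refine ⟨Measure.dirac h.toNNReal, inferInstance, fun n => ?_⟩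
    rw [lintegral_dirac]
    simp only [zero_mul, add_zero, prod_const, card_range]
    rw [ENNReal.ofReal_pow hh, ENNReal.ofReal]
  rcases hh.eq_or_lt with rfl | hh
  · refine ⟨Measure.dirac 0, inferInstance, fun n => ?_⟩
    rw [lintegral_dirac]
    rcases n with _ | n
    · simp
    · rw [prod_range_succ']
      simp
  have := isProbabilityMeasure_gammaMeasure (div_pos hh ha) (inv_pos.2 ha)
  refine ⟨(gammaMeasure (h / a) a⁻¹).map Real.toNNReal,
    Measure.isProbabilityMeasure_map (by fun_prop), fun n => ?_⟩
  rw [lintegral_map (by fun_prop) measurable_real_toNNReal]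
  refine (lintegral_ofReal_pow_gammaMeasure (div_pos hh ha) (inv_pos.2 ha) n).trans ?_
  congr 1
  exact prod_congr rfl fun i _ => by field_simp

theorem isStieltjesMoment_prod {h a : ℝ} (hh : 0 ≤ h) (ha : 0 ≤ a) :
    IsStieltjesMoment fun n => ∏ i ∈ range n, (h + a * i) := by
  obtain ⟨γ, -, hγ⟩ := exists_lintegral_pow_eq_prod hh ha
  exact isStieltjesMoment_of_lintegral (fun n => prod_nonneg fun i _ => by positivity) γ hγ

theorem factorial_mul_choose_eq_prod (r : ℝ) (n : ℕ) :
    (n.factorial : ℝ) * Ring.choose r n = ∏ i ∈ range n, (r - i) := by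
  rw [← nsmul_eq_mul, ← Ring.descPochhammer_eq_factorial_smul_choose, ← Polynomial.aeval_eq_smeval,
    Polynomial.aeval_def, Polynomial.eval₂_eq_eval_map, descPochhammer_map,
    descPochhammer_eval_eq_prod_range]

theorem eq_prod_of_mk_eq_binomialSeries {a b : ℝ} (ha : a ≠ 0) (hb : b ≠ 0) {f : ℕ → ℝ}
    (hf : PowerSeries.mk (fun n => if n = 0 then 0 else f n / (n.factorial : ℝ)) =
      PowerSeries.C b⁻¹ *
        (PowerSeries.rescale (-(a * b)) (PowerSeries.binomialSeries ℝ (-(1 / a) : ℝ)) - 1))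
    (n : ℕ) : f (n + 1) = ∏ i ∈ range n, (b * (1 + a) + a * b * i) := by
  have hcoeff := congrArg (PowerSeries.coeff (n + 1)) hf
  rw [PowerSeries.coeff_mk, if_neg n.succ_ne_zero, PowerSeries.coeff_C_mul, map_sub,
    PowerSeries.coeff_rescale, PowerSeries.binomialSeries_coeff, PowerSeries.coeff_one,
    if_neg n.succ_ne_zero, sub_zero, smul_eq_mul, mul_one,
    div_eq_iff (Nat.cast_ne_zero.2 (n + 1).factorial_ne_zero)] at hcoeff
  calc f (n + 1)
      = b⁻¹ * ((-(a * b)) ^ (n + 1)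
          * ((n + 1).factorial * Ring.choose (-(1 / a) : ℝ) (n + 1))) := by
        rw [hcoeff]
        ring
    _ = b⁻¹ * ∏ i ∈ range (n + 1), (b + a * b * i) := by
        rw [factorial_mul_choose_eq_prod, ← card_range (n + 1), ← prod_const, card_range,
          ← prod_mul_distrib]
        congr 1
        refine prod_congr rfl fun i _ => ?_
        field_simp
        ring
    _ = ∏ i ∈ range n, (b * (1 + a) + a * b * i) := by
        rw [prod_range_succ', Nat.cast_zero, mul_zero, add_zero, mul_comm _ b,
          inv_mul_cancel_left₀ hb]
        refine prod_congr rfl fun i _ => ?_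
        push_cast
        ring

theorem eq_pow_of_mk_eq_exp {b : ℝ} (hb : b ≠ 0) {f : ℕ → ℝ}
    (hf : PowerSeries.mk (fun n => if n = 0 then 0 else f n / (n.factorial : ℝ)) =
      PowerSeries.C b⁻¹ * (PowerSeries.rescale b (PowerSeries.exp ℝ) - 1)) (n : ℕ) :
    f (n + 1) = b ^ n := by
  have hcoeff := congrArg (PowerSeries.coeff (n + 1)) hf
  have hfac : ((n + 1).factorial : ℝ) ≠ 0 := Nat.cast_ne_zero.2 (n + 1).factorial_ne_zero
  rw [PowerSeries.coeff_mk, if_neg n.succ_ne_zero, PowerSeries.coeff_C_mul, map_sub,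
    PowerSeries.coeff_rescale, PowerSeries.coeff_exp, PowerSeries.coeff_one,
    if_neg n.succ_ne_zero, sub_zero, div_eq_iff hfac] at hcoeff
  rw [hcoeff, map_div₀, map_one, map_natCast]
  field_simp
  ring

theorem hasSum_poisson_descFactorial (x : ℝ) (j : ℕ) :
    HasSum (fun K : ℕ => Real.exp (-x) * x ^ K / K.factorial * K.descFactorial j) (x ^ j) := by
  have hshift : ∀ K : ℕ, Real.exp (-x) * x ^ (K + j) / (K + j).factorial * (K + j).descFactorial j
      = Real.exp (-x) * x ^ j * (x ^ K / K.factorial) := fun K => by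
    have hfac : ((K + j).factorial : ℝ) = K.factorial * (K + j).descFactorial j := by
      have := Nat.factorial_mul_descFactorial (Nat.le_add_left j K)
      rw [Nat.add_sub_cancel] at this
      exact_mod_cast this.symm
    have hdesc : ((K + j).descFactorial j : ℝ) ≠ 0 :=
      right_ne_zero_of_mul (hfac ▸ Nat.cast_ne_zero.2 (K + j).factorial_ne_zero)
    rw [hfac]
    field_simp
    ring
  have hexp := (NormedSpace.expSeries_div_hasSum_exp x).mul_left (Real.exp (-x) * x ^ j)
  rw [← Real.exp_eq_exp_ℝ, mul_right_comm, ← Real.exp_add, neg_add_cancel, Real.exp_zero, one_mul]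
    at hexp
  rw [← hasSum_nat_add_iff' j, sum_eq_zero fun i hi => by
    rw [Nat.descFactorial_eq_zero_iff_lt.2 (mem_range.1 hi), Nat.cast_zero, mul_zero], sub_zero]
  simpa only [hshift] using hexp

theorem hasSum_poisson_prod (a : ℕ) (d x : ℝ) (n : ℕ) :
    HasSum (fun K : ℕ => Real.exp (-x) * x ^ K / K.factorial *
      ∏ i ∈ range n, (K + a * d + a * i)) ((genLahPoly a 1 1 d 0 n).eval x) := by
  have hprod : ∀ K : ℕ, ∏ i ∈ range n, (K + a * d + a * i : ℝ)
      = ∑ j ∈ range (n + 1), (genLahPoly a 1 1 d 0 n).coeff j * K.descFactorial j := fun K => by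
    rw [sum_coeff_genLahPoly_mul_descFactorial a 1 d n K n.lt_succ_self]
    exact prod_congr rfl fun i _ => by ring
  rw [Polynomial.eval_eq_sum_range' (Nat.lt_succ_of_le (natDegree_genLahPoly_le a 1 1 d 0 n))]
  simp only [hprod, mul_sum, mul_left_comm _ (Polynomial.coeff _ _)]
  exact hasSum_sum fun j _ => (hasSum_poisson_descFactorial x j).mul_left _

theorem measurable_poissonMeasure : Measurable poissonMeasure := by
  refine Measure.measurable_of_measurable_coe _ fun s _ => ?_
  simp only [poissonMeasure, Measure.sum_apply _ (MeasurableSet.of_discrete (s := s)),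
    Measure.smul_apply, smul_eq_mul]
  fun_prop

theorem exists_kernel_lintegral_pow_eq_eval (a : ℕ) {d : ℝ} (hd : 0 ≤ d) :
    ∃ κ : Kernel ℝ≥0 ℝ≥0, IsMarkovKernel κ ∧ ∀ (h : ℝ≥0) (n : ℕ),
      ∫⁻ x, (x : ℝ≥0∞) ^ n ∂κ h = ENNReal.ofReal ((genLahPoly a 1 1 d 0 n).eval (h : ℝ)) := by
  choose γ hγprob hγ using fun K : ℕ => exists_lintegral_pow_eq_prod (h := K + a * d) (a := a)
    (by positivity) (by positivity)
  let poisson : Kernel ℝ≥0 ℕ := ⟨poissonMeasure, measurable_poissonMeasure⟩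
  have : IsMarkovKernel poisson := ⟨fun h => inferInstanceAs (IsProbabilityMeasure Po(h))⟩
  have : IsMarkovKernel (Kernel.ofFunOfCountable γ) := ⟨hγprob⟩
  refine ⟨Kernel.ofFunOfCountable γ ∘ₖ poisson, inferInstance, fun h n => ?_⟩
  have hsum := hasSum_poisson_prod a d h n
  rw [Kernel.lintegral_comp _ _ _ (by fun_prop), lintegral_countable']
  rw [← hsum.tsum_eq, ENNReal.ofReal_tsum_of_nonneg _ hsum.summable]
  · refine tsum_congr fun K => ?_
    rw [ENNReal.ofReal_mul (by positivity), mul_comm, ← poissonMeasure_singleton, ← hγ]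
    rfl
  · exact fun K => mul_nonneg (by positivity) (prod_nonneg fun i _ => by positivity)

theorem exists_kernel_lintegral_pow_eq_sum (a : ℕ) {d : ℝ} (hd : 0 ≤ d) :
    ∃ κ : Kernel (ℝ≥0 × ℝ≥0) ℝ≥0, ∀ (h β : ℝ≥0) (n : ℕ),
      ∫⁻ x, (x : ℝ≥0∞) ^ n ∂κ (h, β) = ENNReal.ofReal (∑ m ∈ range (n + 1),
        (genLahPoly a 1 1 d 0 n).coeff m * (h : ℝ) ^ m * (β : ℝ) ^ (n - m)) := by
  obtain ⟨κ, hκmarkov, hκ⟩ := exists_kernel_lintegral_pow_eq_eval a hd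
  have hzero : MeasurableSet {z : ℝ≥0 × ℝ≥0 | z.2 = 0} := measurable_snd (measurableSet_singleton 0)
  let scaled : Kernel (ℝ≥0 × ℝ≥0) ℝ≥0 :=
    (κ.comap (fun z => z.1 / z.2) (by fun_prop) ×ₖ
      Kernel.deterministic Prod.snd measurable_snd).map fun p => p.1 * p.2
  classical
  refine ⟨Kernel.piecewise hzero (Kernel.deterministic Prod.fst measurable_fst) scaled,
    fun h β n => ?_⟩
  rw [Kernel.lintegral_piecewise]
  by_cases hβ : β = 0
  · rw [if_pos (show (h, β) ∈ {z : ℝ≥0 × ℝ≥0 | z.2 = 0} from hβ),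
      Kernel.lintegral_deterministic, hβ, sum_eq_single_of_mem n (by simp), coeff_genLahPoly_self]
    · simp [ENNReal.ofReal_pow]
    · intro m hm hmn
      rw [mem_range] at hm
      rw [NNReal.coe_zero, zero_pow (by omega), mul_zero]
  · have hsum : ∑ m ∈ range (n + 1),
        (genLahPoly a 1 1 d 0 n).coeff m * (h : ℝ) ^ m * (β : ℝ) ^ (n - m)
          = (genLahPoly a 1 1 d 0 n).eval ((h / β : ℝ≥0) : ℝ) * (β : ℝ) ^ n := by
      rw [Polynomial.eval_eq_sum_range' (Nat.lt_succ_of_le (natDegree_genLahPoly_le a 1 1 d 0 n)),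
        sum_mul]
      refine sum_congr rfl fun m hm => ?_
      have hβ' : (β : ℝ) ≠ 0 := NNReal.coe_ne_zero.2 hβ
      rw [pow_sub₀ _ hβ' (Nat.lt_succ_iff.1 (mem_range.1 hm)), NNReal.coe_div, div_pow]
      field_simp
    rw [if_neg (show (h, β) ∉ {z : ℝ≥0 × ℝ≥0 | z.2 = 0} from hβ), hsum,
      Kernel.lintegral_map _ (by fun_prop) _ (by fun_prop),
      Kernel.lintegral_prod_deterministic _ _ _ (by fun_prop), ENNReal.ofReal_mul' (by positivity),
      ← hκ, ENNReal.ofReal_pow β.coe_nonneg, ENNReal.ofReal_coe_nnreal]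
    simp only [ENNReal.coe_mul, mul_pow]
    rw [lintegral_mul_const _ (by fun_prop), Kernel.comap_apply]

theorem exists_kernel_lintegral_pow_eq_sum_coeff (a : ℕ) {b c d l : ℝ} (hb : 0 ≤ b) (hc : 0 ≤ c)
    (hd : 0 ≤ d) (hl : 0 ≤ l) :
    ∃ κ : Kernel (ℝ≥0 × ℝ≥0) ℝ≥0, ∀ (z : ℝ≥0 × ℝ≥0) (n : ℕ),
      ∫⁻ t, (t : ℝ≥0∞) ^ n ∂κ z = ∑ k ∈ range (n + 1),
        ENNReal.ofReal ((genLahPoly a b c d l n).coeff k)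
          * ((z.1 : ℝ≥0∞) ^ k * (z.2 : ℝ≥0∞) ^ (n - k)) := by
  have hT : ∀ n k, 0 ≤ (genLahPoly a b c d l n).coeff k :=
    coeff_genLahPoly_mem (N := Subsemiring.nonneg ℝ) a hb hc hd hl
  obtain ⟨κ, hκ⟩ := exists_kernel_lintegral_pow_eq_sum a hd
  lift b to ℝ≥0 using hb
  lift c to ℝ≥0 using hc
  lift l to ℝ≥0 using hl
  refine ⟨κ.comap (fun z => (c * (z.1 + l * z.2), b * z.2)) (by fun_prop), fun z n => ?_⟩
  have hnonneg : ∀ k, 0 ≤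
      (genLahPoly a (b : ℝ) c d l n).coeff k * (z.1 : ℝ) ^ k * (z.2 : ℝ) ^ (n - k) := fun k =>
    mul_nonneg (mul_nonneg (hT n k) (by positivity)) (by positivity)
  rw [Kernel.comap_apply, hκ]
  push_cast
  rw [← sum_coeff_genLahPoly_mul_pow_mul_pow, ENNReal.ofReal_sum_of_nonneg fun k _ => hnonneg k]
  refine sum_congr rfl fun k _ => ?_
  rw [mul_assoc, ENNReal.ofReal_mul (hT n k), ENNReal.ofReal_mul (by positivity),
    ENNReal.ofReal_pow z.1.coe_nonneg, ENNReal.ofReal_pow z.2.coe_nonneg,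
    ENNReal.ofReal_coe_nnreal, ENNReal.ofReal_coe_nnreal]

theorem preservesSM_genLahPoly (a : ℕ) {b c d l : ℝ} (hb : 0 ≤ b) (hc : 0 ≤ c) (hd : 0 ≤ d)
    (hl : 0 ≤ l) : PreservesSM fun n k => (genLahPoly a b c d l n).coeff k := by
  intro x y hx hy
  have hT : ∀ n k, 0 ≤ (genLahPoly a b c d l n).coeff k :=
    coeff_genLahPoly_mem (N := Subsemiring.nonneg ℝ) a hb hc hd hl
  have hterm : ∀ n k, 0 ≤ (genLahPoly a b c d l n).coeff k * x k * y (n - k) := fun n k =>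
    mul_nonneg (mul_nonneg (hT n k) (hx.nonneg k)) (hy.nonneg _)
  obtain ⟨μ, _, hμ⟩ := hx.exists_lintegral
  obtain ⟨ν, _, hν⟩ := hy.exists_lintegral
  obtain ⟨κ, hκ⟩ := exists_kernel_lintegral_pow_eq_sum_coeff a hb hc hd hl
  refine isStieltjesMoment_of_lintegral (fun n => sum_nonneg fun k _ => hterm n k)
    ((μ.prod ν).bind κ) fun n => ?_
  rw [Measure.lintegral_bind κ.aemeasurable (by fun_prop)]
  simp only [hκ]
  rw [lintegral_finsetSum _ fun k _ => by fun_prop,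
    ENNReal.ofReal_sum_of_nonneg fun k _ => hterm n k]
  refine sum_congr rfl fun k _ => ?_
  rw [lintegral_const_mul _ (by fun_prop), lintegral_prod_mul (f := fun s : ℝ≥0 => (s : ℝ≥0∞) ^ k)
    (g := fun r : ℝ≥0 => (r : ℝ≥0∞) ^ (n - k)) (by fun_prop) (by fun_prop), hμ, hν, mul_assoc,
    ENNReal.ofReal_mul (hT n k), ENNReal.ofReal_mul (hx.nonneg k)]

end StieltjesMoments

section BranchedFraction

open Polynomial

variable {R : Type*} [CommRing R]

theorem dvd_prod_sub_prod {ι : Type*} (s : Finset ι) {f g : ι → R} {x : R}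
    (h : ∀ i ∈ s, x ∣ f i - g i) : x ∣ ∏ i ∈ s, f i - ∏ i ∈ s, g i := by
  simp only [← Ideal.mem_span_singleton, ← Ideal.Quotient.eq, map_prod] at h ⊢
  exact prod_congr rfl h

theorem branchedTrunc_succ_mul (m : ℕ) (α : ℕ → R) (N k : ℕ) :
    branchedTrunc m α (N + 1) k * (1 - PowerSeries.C (α (k + m)) * PowerSeries.X *
      ∏ i ∈ Icc 1 m, branchedTrunc m α N (k + i)) = 1 := by
  rw [mul_comm]
  exact PowerSeries.mul_invOfUnit _ _ (by simp)

theorem X_pow_dvd_branchedTrunc_sub {m : ℕ} {α : ℕ → R} {F : ℕ → PowerSeries R}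
    (hF : ∀ k, F k * (1 - PowerSeries.C (α (k + m)) * PowerSeries.X *
      ∏ i ∈ Icc 1 m, F (k + i)) = 1) (N k : ℕ) :
    (PowerSeries.X : PowerSeries R) ^ (N + 1) ∣ branchedTrunc m α N k - F k := by
  induction N generalizing k with
  | zero =>
    have hconst := congrArg PowerSeries.constantCoeff (hF k)
    simp only [map_mul, map_sub, map_one, PowerSeries.constantCoeff_X, mul_zero, zero_mul,
      sub_zero, mul_one] at hconst
    rw [zero_add, pow_one, PowerSeries.X_dvd_iff, branchedTrunc, map_sub, map_one, hconst, sub_self]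
  | succ N ih =>
    have hdiff : branchedTrunc m α (N + 1) k - F k
        = branchedTrunc m α (N + 1) k * F k * PowerSeries.C (α (k + m)) * (PowerSeries.X *
          (∏ i ∈ Icc 1 m, branchedTrunc m α N (k + i) - ∏ i ∈ Icc 1 m, F (k + i))) := by
      linear_combination F k * branchedTrunc_succ_mul m α N k
        - branchedTrunc m α (N + 1) k * hF k
    rw [hdiff, pow_succ']
    exact Dvd.dvd.mul_left (mul_dvd_mul_left _ (dvd_prod_sub_prod _ fun i _ => ih (k + i))) _

theorem isBranchedSFraction_of_mul_eq_one {m : ℕ} {α : ℕ → R} {F : ℕ → PowerSeries R}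
    (hF : ∀ k, F k * (1 - PowerSeries.C (α (k + m)) * PowerSeries.X *
      ∏ i ∈ Icc 1 m, F (k + i)) = 1) : IsBranchedSFraction m α (F 0) := fun n => by
  refine ⟨n, fun N hN => ?_⟩
  have hcoeff := PowerSeries.X_pow_dvd_iff.1 (X_pow_dvd_branchedTrunc_sub hF N 0) n (by omega)
  rwa [map_sub, sub_eq_zero] at hcoeff

-- The Euler–Gauss recurrence method: the ratios `G (k + 1) / G k` are the tails of the fraction.
theorem isBranchedSFraction_of_sub_eq {m : ℕ} {α : ℕ → R} {G : ℕ → PowerSeries R}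
    (hzero : G 0 = 1) (hconst : ∀ k, PowerSeries.constantCoeff (G k) = 1)
    (hsub : ∀ k, G (k + 1) - G k = PowerSeries.C (α (k + m)) * PowerSeries.X * G (k + m + 1)) :
    IsBranchedSFraction m α (G 1) := by
  have hunit : ∀ k, IsUnit (G k) := fun k =>
    PowerSeries.isUnit_iff_constantCoeff.2 (by rw [hconst]; exact isUnit_one)
  choose u hu using hunit
  let F : ℕ → PowerSeries R := fun k => G (k + 1) * ↑(u k)⁻¹
  have hFG : ∀ k, F k * G k = G (k + 1) := fun k => by
    rw [← hu k, Units.inv_mul_cancel_right]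
  have hprod : ∀ k j, (∏ i ∈ Icc 1 j, F (k + i)) * G (k + 1) = G (k + j + 1) := fun k j => by
    induction j with
    | zero => simp
    | succ j ih =>
      rw [prod_Icc_succ_top (by omega), mul_right_comm, ih, mul_comm]
      exact hFG (k + (j + 1))
  have hF0 : F 0 = G 1 := by rw [← hFG 0, hzero, mul_one]
  rw [← hF0]
  refine isBranchedSFraction_of_mul_eq_one fun k => (u k).isUnit.mul_right_cancel ?_
  rw [hu]
  linear_combination (1 - PowerSeries.C (α (k + m)) * PowerSeries.X *
    ∏ i ∈ Icc 1 m, F (k + i)) * hFG k + hsub k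
      - PowerSeries.C (α (k + m)) * PowerSeries.X * hprod k m

theorem branchedCoeffs_mul_add_add (m : ℕ) (u b : R) (j : ℕ) {r : ℕ} (hr : r < m + 1) :
    branchedCoeffs m u b ((m + 1) * j + r + m) = if r = 0 then u else (j + 1 : ℕ) * b := by
  rw [branchedCoeffs, Nat.add_sub_cancel, Nat.mul_add_mod, Nat.mod_eq_of_lt hr,
    Nat.mul_add_div m.succ_pos, Nat.div_eq_of_lt hr, add_zero]

theorem coeff_oneAddDeriv_pow_of_forall_coeff_eq_zero (u : R) {p : R[X]} {n : ℕ}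
    (hp : ∀ k, n < k → p.coeff k = 0) (r : ℕ) :
    (∀ k, n < k → ((oneAddDeriv u ^ r) p).coeff k = 0) ∧
      ((oneAddDeriv u ^ r) p).coeff n = p.coeff n := by
  induction r with
  | zero => exact ⟨hp, rfl⟩
  | succ r ih =>
    rw [pow_succ', Module.End.mul_apply]
    refine ⟨fun k hk => ?_, ?_⟩
    · rw [coeff_oneAddDeriv, ih.1 k hk, ih.1 (k + 1) (by omega), mul_zero, add_zero]
    · rw [coeff_oneAddDeriv, ih.2, ih.1 (n + 1) (by omega), mul_zero, add_zero]

theorem genLahPoly_one_zero_succ (a : ℕ) (b l : R) (n : ℕ) :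
    genLahPoly a b 1 0 l (n + 1)
      = (X + C l) * (oneAddDeriv b ^ (a + 1)) (genLahPoly a b 1 0 l n) := by
  have h := genLahPoly_succ_eq_lahProductionOp a b 1 0 l n
  rw [mul_one] at h
  rw [h, lahProductionOp, mul_zero, map_zero, zero_add, eulerOp, C_1, one_mul, mul_assoc,
    ← pow_succ', Module.End.mul_apply, LinearMap.mulLeft_apply]

/-- The power series `∑ n, [X ^ j] (1 + b d/dX) ^ r T_{n + j} * t ^ n`, where `T_n` are the row
polynomials of the generalized Lah triangle with `c = 1` and `d = 0`. Listed block by block, for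
`j = 0, 1, …` and `r = 0, …, a + 1`, they satisfy the Euler–Gauss recurrence. -/
noncomputable def lahSeries (a : ℕ) (b l : R) (j r : ℕ) : PowerSeries R :=
  PowerSeries.mk fun n => ((oneAddDeriv b ^ r) (genLahPoly a b 1 0 l (n + j))).coeff j

theorem coeff_oneAddDeriv_pow_genLahPoly_of_lt (a : ℕ) (b l : R) (r : ℕ) {n k : ℕ} (h : n < k) :
    ((oneAddDeriv b ^ r) (genLahPoly a b 1 0 l n)).coeff k = 0 :=
  (coeff_oneAddDeriv_pow_of_forall_coeff_eq_zero b
    (fun _ hk => coeff_genLahPoly_of_lt a b 1 0 l hk) r).1 k h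

theorem constantCoeff_lahSeries (a : ℕ) (b l : R) (j r : ℕ) :
    PowerSeries.constantCoeff (lahSeries a b l j r) = 1 := by
  rw [← PowerSeries.coeff_zero_eq_constantCoeff_apply, lahSeries, PowerSeries.coeff_mk, zero_add,
    (coeff_oneAddDeriv_pow_of_forall_coeff_eq_zero b
      (fun _ hk => coeff_genLahPoly_of_lt a b 1 0 l hk) r).2, coeff_genLahPoly_self, one_pow]

theorem lahSeries_succ_right_sub (a : ℕ) (b l : R) (j r : ℕ) :
    lahSeries a b l j (r + 1) - lahSeries a b l j r
      = PowerSeries.C ((j + 1 : ℕ) * b) * PowerSeries.X * lahSeries a b l (j + 1) r := by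
  ext n
  rw [map_sub, mul_assoc, PowerSeries.coeff_C_mul, lahSeries, lahSeries, PowerSeries.coeff_mk,
    PowerSeries.coeff_mk, pow_succ', Module.End.mul_apply, coeff_oneAddDeriv]
  rcases n with _ | n
  · rw [PowerSeries.coeff_zero_X_mul,
      coeff_oneAddDeriv_pow_genLahPoly_of_lt a b l r (by omega : 0 + j < j + 1)]
    ring
  · rw [PowerSeries.coeff_succ_X_mul, lahSeries, PowerSeries.coeff_mk,
      (by omega : n + (j + 1) = n + 1 + j)]
    push_cast
    ring

theorem lahSeries_succ_left_sub (a : ℕ) (b l : R) (j : ℕ) :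
    lahSeries a b l (j + 1) 0 - lahSeries a b l j (a + 1)
      = PowerSeries.C l * PowerSeries.X * lahSeries a b l (j + 1) (a + 1) := by
  ext n
  rw [map_sub, mul_assoc, PowerSeries.coeff_C_mul, lahSeries, lahSeries, PowerSeries.coeff_mk,
    PowerSeries.coeff_mk, pow_zero, Module.End.one_apply, ← add_assoc, genLahPoly_one_zero_succ,
    add_mul, coeff_add, coeff_X_mul, coeff_C_mul, add_sub_cancel_left]
  rcases n with _ | n
  · rw [PowerSeries.coeff_zero_X_mul,
      coeff_oneAddDeriv_pow_genLahPoly_of_lt a b l (a + 1) (by omega)]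
  · rw [PowerSeries.coeff_succ_X_mul, lahSeries, PowerSeries.coeff_mk,
      (by omega : n + (j + 1) = n + 1 + j)]

theorem lahSeries_zero_zero_sub_one (a : ℕ) (b l : R) :
    lahSeries a b l 0 0 - 1 = PowerSeries.C l * PowerSeries.X * lahSeries a b l 0 (a + 1) := by
  ext n
  rw [map_sub, mul_assoc, PowerSeries.coeff_C_mul]
  rcases n with _ | n
  · rw [PowerSeries.coeff_zero_X_mul]
    simp [lahSeries, genLahPoly]
  · rw [PowerSeries.coeff_succ_X_mul, lahSeries, lahSeries, PowerSeries.coeff_mk,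
      PowerSeries.coeff_mk, pow_zero, Module.End.one_apply, add_zero, add_zero,
      genLahPoly_one_zero_succ, add_mul, coeff_add, coeff_X_mul_zero, coeff_C_mul,
      PowerSeries.coeff_one, if_neg n.succ_ne_zero, zero_add, sub_zero]

theorem isBranchedSFraction_lahSeries (a : ℕ) (b l : R) :
    IsBranchedSFraction (a + 1) (branchedCoeffs (a + 1) l b) (lahSeries a b l 0 0) := by
  let G : ℕ → PowerSeries R
    | 0 => 1
    | k + 1 => lahSeries a b l (k / (a + 2)) (k % (a + 2))
  have hG : ∀ j r, r < a + 2 → G ((a + 2) * j + r + 1) = lahSeries a b l j r := fun j r hr => by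
    change lahSeries a b l _ _ = _
    rw [Nat.mul_add_div (by omega), Nat.div_eq_of_lt hr, add_zero, Nat.mul_add_mod,
      Nat.mod_eq_of_lt hr]
  rw [← hG 0 0 (by omega)]
  refine isBranchedSFraction_of_sub_eq rfl ?_ fun k => ?_
  · rintro (_ | k)
    exacts [map_one _, constantCoeff_lahSeries a b l _ _]
  obtain ⟨j, r, hr, rfl⟩ : ∃ j r, r < a + 2 ∧ k = (a + 2) * j + r :=
    ⟨k / (a + 2), k % (a + 2), Nat.mod_lt _ (by omega), (Nat.div_add_mod k _).symm⟩
  rw [hG j r hr, branchedCoeffs_mul_add_add (a + 1) l b j hr]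
  rcases r with _ | r
  · rw [if_pos rfl, add_zero, hG j (a + 1) (by omega)]
    rcases j with _ | j
    · exact lahSeries_zero_zero_sub_one a b l
    · rw [(by ring : (a + 2) * (j + 1) = (a + 2) * j + (a + 1) + 1), hG j (a + 1) (by omega)]
      exact lahSeries_succ_left_sub a b l j
  · rw [if_neg r.succ_ne_zero, ← add_assoc, hG j r (by omega),
      (by ring : (a + 2) * j + r + 1 + (a + 1) + 1 = (a + 2) * (j + 1) + r + 1),
      hG (j + 1) r (by omega)]
    exact lahSeries_succ_right_sub a b l j r

theorem coeff_zero_genLahPoly_eq_one (a : ℕ) (b c d l : R) (n : ℕ) :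
    (genLahPoly a b c d l n).coeff 0 = (genLahPoly a b 1 d (c * l) n).coeff 0 := by
  rw [coeff_genLahPoly_eq_sum a b c d l n.lt_succ_self,
    coeff_genLahPoly_eq_sum a b 1 d (c * l) n.lt_succ_self]
  refine sum_congr rfl fun m hm => ?_
  have hm : m ≤ n := mem_range_succ_iff.1 hm
  rw [coeff_genLahPoly_eq_pow_mul a b c d hm, coeff_genLahPoly_eq_pow_mul a b 1 d hm, mul_pow,
    Nat.sub_zero]
  ring

theorem map_genLahPoly {S : Type*} [CommRing S] (φ : R →+* S) (a : ℕ) (b c d l : R) (n : ℕ) :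
    (genLahPoly a b c d l n).map φ = genLahPoly a (φ b) (φ c) (φ d) (φ l) n := by
  induction n with
  | zero => simp [genLahPoly]
  | succ n ih => simp [genLahPoly, ← ih, derivative_map]

theorem genLahPoly_eq_coeff_zero (a : ℕ) (b c d l : R) (n : ℕ) :
    genLahPoly a b c d l n = (genLahPoly a (C b) (C c) (C d) (X + C l) n).coeff 0 := by
  rw [add_comm, ← eval_genLahPoly, ← map_genLahPoly, eval_map, eval₂_C_X]

theorem isBranchedSFraction_coeff_zero_genLahPoly (a : ℕ) (b c l : R) :
    IsBranchedSFraction (a + 1) (branchedCoeffs (a + 1) (c * l) b)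
      (PowerSeries.mk fun n => (genLahPoly a b c 0 l n).coeff 0) := by
  simp_rw [fun n => coeff_zero_genLahPoly_eq_one a b c 0 l n]
  exact isBranchedSFraction_lahSeries a b (c * l)

theorem isBranchedSFraction_genLahPoly (a : ℕ) (b c l : R) :
    IsBranchedSFraction (a + 1) (branchedCoeffs (a + 1) (C c * (X + C l)) (C b))
      (PowerSeries.mk (genLahPoly a b c 0 l)) := by
  have h := isBranchedSFraction_coeff_zero_genLahPoly a (C b) (C c) (X + C l)
  simpa only [← C_0 (R := R), ← genLahPoly_eq_coeff_zero] using h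

end BranchedFraction

section RealRoots

open Polynomial

theorem hasMinorsIn_monomialMatrix_mulLeft_C_mul_prod {R : Type*} [CommRing R] {N : Subsemiring R}
    {e : R} (he : e ∈ N) {s : Multiset R} (hs : ∀ x ∈ s, x ∈ N) :
    HasMinorsIn N (monomialMatrix (LinearMap.mulLeft R (C e * (s.map fun x => X + C x).prod))) := by
  induction s using Multiset.induction_on with
  | empty => simpa using hasMinorsIn_monomialMatrix_mulLeft_linear N.zero_mem he
  | cons x s ih =>
    have hlinear := hasMinorsIn_monomialMatrix_mulLeft_linear N.one_mem
      (hs x (Multiset.mem_cons_self x s))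
    rw [C_1, one_mul] at hlinear
    rw [Multiset.map_cons, Multiset.prod_cons, mul_left_comm, LinearMap.mulLeft_mul]
    exact (ih fun y hy => hs y (Multiset.mem_cons_of_mem hy)).monomialMatrix_mul hlinear

theorem nonpos_of_mem_roots_of_forall_coeff_nonneg {R : Type*} [CommRing R] [LinearOrder R]
    [IsStrictOrderedRing R] {p : R[X]} (hp : ∀ k, 0 ≤ p.coeff k) {x : R} (hx : x ∈ p.roots) :
    x ≤ 0 := by
  by_contra! hpos
  have heval := (mem_roots'.1 hx).2
  rw [IsRoot, eval_eq_sum_range, sum_eq_zero_iff_of_nonneg fun k _ =>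
    mul_nonneg (hp k) (pow_nonneg hpos.le k)] at heval
  have hlead := heval p.natDegree (self_mem_range_succ _)
  exact mul_ne_zero (leadingCoeff_ne_zero.2 (mem_roots'.1 hx).1) (pow_pos hpos _).ne' hlead

theorem isPF_coeff_of_splits {p : ℝ[X]} (hsplits : p.Splits) (hcoeff : ∀ k, 0 ≤ p.coeff k) :
    IsPF p.coeff := by
  have hroots : ∀ x ∈ p.roots.map Neg.neg, x ∈ Subsemiring.nonneg ℝ := fun x hx => by
    obtain ⟨y, hy, rfl⟩ := Multiset.mem_map.1 hx
    exact neg_nonneg.2 (nonpos_of_mem_roots_of_forall_coeff_nonneg hcoeff hy)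
  have hp : p = C p.leadingCoeff * ((p.roots.map Neg.neg).map fun x => X + C x).prod := by
    conv_lhs => rw [hsplits.eq_prod_roots]
    simp [sub_eq_add_neg]
  have hminors := hasMinorsIn_monomialMatrix_mulLeft_C_mul_prod (N := Subsemiring.nonneg ℝ)
    (hcoeff p.natDegree) hroots
  rw [← leadingCoeff, ← hp] at hminors
  intro r rows cols hrows hcols
  have hdet := hminors.transpose r rows cols hrows hcols
  simp only [monomialMatrix, LinearMap.mulLeft_apply, coeff_mul_X_pow'] at hdet
  exact hdet

theorem im_eq_zero_of_splits {p : ℝ[X]} (hp : p.Splits) (h0 : p ≠ 0) {z : ℂ}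
    (hz : aeval z p = 0) : z.im = 0 := by
  obtain ⟨x, rfl⟩ := hp.mem_range_of_isRoot h0 (i := algebraMap ℝ ℂ)
    (by rwa [IsRoot, eval_map_algebraMap])
  exact Complex.ofReal_im x

theorem splits_of_forall_im_eq_zero {p : ℝ[X]} (h : ∀ z : ℂ, aeval z p = 0 → z.im = 0) :
    p.Splits := by
  refine Splits.of_splits_map (algebraMap ℝ ℂ) (IsAlgClosed.splits _) fun z hz => ⟨z.re, ?_⟩
  have hroot := (mem_roots'.1 hz).2
  rw [IsRoot, eval_map_algebraMap] at hroot
  exact Complex.ext rfl (h z hroot).symm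

theorem im_mul_sum_inv_sub_mul_im_nonneg {s : Multiset ℝ} (hs : ∀ w ∈ s, w ≤ 0) (z : ℂ) :
    0 ≤ (z * (s.map fun w : ℝ => 1 / (z - w)).sum).im * z.im := by
  induction s using Multiset.induction_on with
  | empty => simp
  | cons w s ih =>
    have hterm : (z * (1 / (z - w))).im * z.im = -w * z.im ^ 2 / Complex.normSq (z - w) := by
      rw [mul_one_div, Complex.div_im]
      simp only [Complex.sub_re, Complex.sub_im, Complex.ofReal_re, Complex.ofReal_im]
      ring
    rw [Multiset.map_cons, Multiset.sum_cons, mul_add, Complex.add_im, add_mul, hterm]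
    have hw : 0 ≤ -w := neg_nonneg.2 (hs w (Multiset.mem_cons_self w s))
    exact add_nonneg (div_nonneg (mul_nonneg hw (sq_nonneg _)) (Complex.normSq_nonneg _))
      (ih fun v hv => hs v (Multiset.mem_cons_of_mem hv))

-- At a non-real zero `z`, the imaginary parts of `c * z` and `b * z * p' / p` have the same sign.
theorem splits_C_mul_add_X_mul {p : ℝ[X]} (hp : p.Splits) (h0 : p ≠ 0)
    (hroots : ∀ w ∈ p.roots, w ≤ 0) {b c : ℝ} (hb : 0 ≤ b) (hc : 0 < c) (γ : ℝ) :
    (C γ * p + X * (C c * p + C b * derivative p)).Splits := by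
  refine splits_of_forall_im_eq_zero fun z hz => ?_
  by_contra him
  have hpz : aeval z p ≠ 0 := fun h => him (im_eq_zero_of_splits hp h0 h)
  have hsum := im_mul_sum_inv_sub_mul_im_nonneg hroots z
  set L : ℂ := (p.roots.map fun w : ℝ => 1 / (z - w)).sum
  have hderiv : aeval z (derivative p) = aeval z p * L := by
    have h := (hp.map (algebraMap ℝ ℂ)).eval_derivative_eq_eval_mul_sum (x := z)
      (by rwa [eval_map_algebraMap])
    rw [derivative_map, eval_map_algebraMap, eval_map_algebraMap, hp.roots_map,
      Multiset.map_map] at h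
    exact h
  have hfactor : aeval z p * (γ + c * z + b * (z * L)) = 0 := by
    rw [← hz]
    simp only [map_add, map_mul, aeval_X, aeval_C, Complex.coe_algebraMap, hderiv]
    ring
  have himag : c * z.im + b * (z * L).im = 0 := by
    have h := congrArg Complex.im ((mul_eq_zero.1 hfactor).resolve_left hpz)
    rwa [Complex.add_im, Complex.add_im, Complex.ofReal_im, Complex.im_ofReal_mul,
      Complex.im_ofReal_mul, zero_add, Complex.zero_im] at h
  have hpos : 0 < c * z.im ^ 2 := by positivity
  have hnonneg : 0 ≤ b * ((z * L).im * z.im) := mul_nonneg hb hsum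
  have : c * z.im ^ 2 + b * ((z * L).im * z.im) = 0 := by linear_combination z.im * himag
  linarith

theorem genLahPoly_zero_eq_C {R : Type*} [CommRing R] (a : ℕ) (b d l : R) (n : ℕ) :
    genLahPoly a b 0 d l n = C (∏ i ∈ range n, a * b * (i + d)) := by
  induction n with
  | zero => simp [genLahPoly]
  | succ n ih =>
    rw [genLahPoly, ih, derivative_C, C_0, mul_zero, zero_mul, add_zero, mul_zero,
      add_zero, ← C_mul, prod_range_succ, mul_comm]

theorem splits_genLahPoly (a : ℕ) {b c d : ℝ} (hb : 0 ≤ b) (hc : 0 ≤ c) (hd : 0 ≤ d) (l : ℝ)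
    (n : ℕ) : (genLahPoly a b c d l n).Splits := by
  rcases hc.eq_or_lt with rfl | hc
  · rw [genLahPoly_zero_eq_C]
    exact Splits.C _
  suffices hzero : (genLahPoly a b c d 0 n).Splits by
    rw [← zero_add l, ← genLahPoly_comp_X_add_C]
    exact hzero.comp_X_add_C l
  induction n with
  | zero => exact Splits.one
  | succ n ih =>
    have hne : genLahPoly a b c d 0 n ≠ 0 := fun h => by
      have hlead := coeff_genLahPoly_self a b c d 0 n
      rw [h, coeff_zero] at hlead
      exact (pow_pos hc n).ne hlead
    have hroots : ∀ w ∈ (genLahPoly a b c d 0 n).roots, w ≤ 0 := fun _ =>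
      nonpos_of_mem_roots_of_forall_coeff_nonneg
        (coeff_genLahPoly_mem (N := Subsemiring.nonneg ℝ) a hb hc.le hd (le_refl (0 : ℝ)) n)
    rw [genLahPoly, C_0, add_zero]
    exact splits_C_mul_add_X_mul ih hne hroots hb hc _

end RealRoots

theorem mainTheorem10_general (a : ℕ) :
    (∀ (K : Type*) [Field K] [CharZero K] [TopologicalSpace K] (b c d l : K) (T : ℕ → ℕ → K),
      IsGenLahTriangle a b c d l T → ∀ n k : ℕ,
      HasSum (fun j : ℕ => 1 / (k.factorial : K) * ∑ i ∈ range (k + j + 1),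
        (-1) ^ ((n : ℤ) + k + j - i) * b ^ ((n : ℤ) - k - j) * c ^ (k + j) * l ^ j
          / j.factorial * (k + j).choose i * ∏ r ∈ range n, (-(i + a * d) - r * a)) (T n k)) ∧
    (∀ (R : Type*) [CommRing R] (N : Subsemiring R), ∀ u ∈ N, ∀ c ∈ N, ∀ d ∈ N, ∀ l ∈ N, ∀ b,
      u * c = b → ∀ T : ℕ → ℕ → R, IsGenLahTriangle a b c d l T →
        HasMinorsIn N (Matrix.of T) ∧ ∀ q ∈ N,
          HasMinorsIn N (Matrix.of fun i j => (rowPoly T (i + j)).eval q) ∧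
          ∀ m ≤ 3, ∀ i, logConvexOp^[m] (fun n => (rowPoly T n).eval q) i ∈ N) ∧
    (1 ≤ a → ∀ b : ℝ, 0 < b → ∀ f : ℕ → ℝ,
      PowerSeries.mk (fun n => if n = 0 then 0 else f n / (n.factorial : ℝ)) =
        PowerSeries.C b⁻¹ *
          (PowerSeries.rescale (-(a * b)) (PowerSeries.binomialSeries ℝ (-(1 / a) : ℝ)) - 1) →
      IsStieltjesMoment fun n => f (n + 1)) ∧
    (a = 0 → ∀ b : ℝ, 0 < b → ∀ f : ℕ → ℝ,
      PowerSeries.mk (fun n => if n = 0 then 0 else f n / (n.factorial : ℝ)) =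
        PowerSeries.C b⁻¹ * (PowerSeries.rescale b (PowerSeries.exp ℝ) - 1) →
      IsStieltjesMoment fun n => f (n + 1)) ∧
    (∀ b c d l : ℝ, 0 ≤ b → 0 ≤ c → 0 ≤ d → 0 ≤ l → ∀ T : ℕ → ℕ → ℝ,
      IsGenLahTriangle a b c d l T → PreservesSM T) ∧
    (∀ (R : Type*) [CommRing R] (b c l : R) (T : ℕ → ℕ → R), IsGenLahTriangle a b c 0 l T →
      IsBranchedSFraction (a + 1)
        (branchedCoeffs (a + 1) (Polynomial.C c * (Polynomial.X + Polynomial.C l))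
          (Polynomial.C b))
        (PowerSeries.mk (rowPoly T)) ∧
      IsBranchedSFraction (a + 1) (branchedCoeffs (a + 1) (c * l) b)
        (PowerSeries.mk fun n => T n 0)) ∧
    (∀ b c d l : ℝ, 0 ≤ b → 0 ≤ c → 0 ≤ d → ∀ T : ℕ → ℕ → ℝ,
      IsGenLahTriangle a b c d l T → ∀ n : ℕ,
        (0 ≤ l → IsPF (T n)) ∧
        (rowPoly T n ≠ 0 → ∀ z : ℂ, Polynomial.aeval z (rowPoly T n) = 0 → z.im = 0)) := by
  refine ⟨fun K _ _ _ b c d l T hT => ?_,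
    fun R _ N u hu c hc d hd l hl b hb T hT => ?_,
    fun ha b hb f hf => ?_, fun _ b hb f hf => ?_,
    fun b c d l hb hc hd hl T hT => hT.eq_coeff ▸ preservesSM_genLahPoly a hb hc hd hl,
    fun R _ b c l T hT => ?_, fun b c d l hb hc hd T hT n => ?_⟩
  · rw [hT.eq_coeff]
    exact hasSum_coeff_genLahPoly a b c d l
  · subst hb
    have hankel := fun q hq => hasMinorsIn_hankel_eval_genLahPoly a (q := q) hu hc hd hl hq
    rw [hT.rowPoly_eq, hT.eq_coeff]
    exact ⟨hasMinorsIn_coeff_genLahPoly a hu hc hd hl, fun q hq =>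
      ⟨hankel q hq, fun m hm => (hankel q hq).logConvexOp_iterate_mem hm⟩⟩
  · simp only [eq_prod_of_mk_eq_binomialSeries (Nat.cast_ne_zero.2 (by omega)) hb.ne' hf]
    exact isStieltjesMoment_prod (by positivity) (by positivity)
  · simp only [eq_pow_of_mk_eq_exp hb.ne' hf]
    simpa using isStieltjesMoment_prod hb.le (le_refl (0 : ℝ))
  · rw [hT.rowPoly_eq, hT.eq_coeff]
    exact ⟨isBranchedSFraction_genLahPoly a b c l,
      isBranchedSFraction_coeff_zero_genLahPoly a b c l⟩
  · rw [hT.rowPoly_eq, hT.eq_coeff]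
    have splits := splits_genLahPoly a hb hc hd l n
    exact ⟨fun hl => isPF_coeff_of_splits splits
      (coeff_genLahPoly_mem (N := Subsemiring.nonneg ℝ) a hb hc hd hl n),
      fun hne _ hz => im_eq_zero_of_splits splits hne hz⟩

theorem mainTheorem10 (a : ℕ) :
    -- (i) explicit formula, for `a ≥ 1`; the factor at the end is a falling factorial
    (1 ≤ a → ∀ (b c d l : ℝ) (T : ℕ → ℕ → ℝ), IsGenLahTriangle a b c d l T → ∀ n k : ℕ,
      HasSum
        (fun j : ℕ => (a : ℝ) ^ n / (k.factorial : ℝ) *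
          ∑ i ∈ Finset.range (k + j + 1),
            (-1 : ℝ) ^ ((n : ℤ) + k + j - i) * b ^ ((n : ℤ) - k - j) * c ^ (k + j) * l ^ j /
              (j.factorial : ℝ) * ((k + j).choose i : ℝ) *
              (descPochhammer ℝ n).eval (-((i + a * d) / a)))
        (T n k)) ∧
    -- (i) for `a = 0`, where `a ^ n (-(i + ad)/a)_n = ∏_{r < n} (-(i + ad) - r a)` is `(-i) ^ n`
    (a = 0 → ∀ (b c d l : ℝ) (T : ℕ → ℕ → ℝ), IsGenLahTriangle a b c d l T → ∀ n k : ℕ,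
      HasSum
        (fun j : ℕ => 1 / (k.factorial : ℝ) *
          ∑ i ∈ Finset.range (k + j + 1),
            (-1 : ℝ) ^ ((n : ℤ) + k + j - i) * b ^ ((n : ℤ) - k - j) * c ^ (k + j) * l ^ j /
              (j.factorial : ℝ) * ((k + j).choose i : ℝ) * (-(i : ℝ)) ^ n)
        (T n k)) ∧
    -- (ii) indeterminates `(b, l) = (X 0, X 1)`, constants `d ∈ ℕ`, `c > 0`
    (∀ (d : ℕ) (c : ℝ), 0 < c → ∀ T : ℕ → ℕ → MvPolynomial (Fin 2) ℝ,
      IsGenLahTriangle a (MvPolynomial.X 0) (MvPolynomial.C c) (d : MvPolynomial (Fin 2) ℝ)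
        (MvPolynomial.X 1) T → IsXTP T) ∧
    -- (iii) `c = b`, indeterminates `(b, d, l) = (X 0, X 1, X 2)`
    (∀ T : ℕ → ℕ → MvPolynomial (Fin 3) ℝ,
      IsGenLahTriangle a (MvPolynomial.X 0) (MvPolynomial.X 0) (MvPolynomial.X 1)
        (MvPolynomial.X 2) T → IsXTP T) ∧
    -- (iv) `c = b`, indeterminates `(b, d, l, q) = (X 0, X 1, X 2, X 3)`
    (∀ T : ℕ → ℕ → MvPolynomial (Fin 4) ℝ,
      IsGenLahTriangle a (MvPolynomial.X 0) (MvPolynomial.X 0) (MvPolynomial.X 1)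
        (MvPolynomial.X 2) T →
        IsXSM (fun n => (rowPoly T n).eval (MvPolynomial.X 3)) ∧
        IsXLogConvexOfOrder 3 (fun n => (rowPoly T n).eval (MvPolynomial.X 3))) ∧
    -- (iv) column `0`: indeterminates `(b, d, l) = (X 0, X 1, X 2)`
    (∀ T : ℕ → ℕ → MvPolynomial (Fin 3) ℝ,
      IsGenLahTriangle a (MvPolynomial.X 0) (MvPolynomial.X 0) (MvPolynomial.X 1)
        (MvPolynomial.X 2) T →
        IsXSM (fun n => T n 0) ∧ IsXLogConvexOfOrder 3 (fun n => T n 0)) ∧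
    -- (v) `∑_{n ≥ 1} f_n t^n / n! = ((1 - a b t) ^ (-1/a) - 1) / b`, for `a ≥ 1`
    (1 ≤ a → ∀ b : ℝ, 0 < b →
      ∀ f : ℕ → ℝ,
        PowerSeries.mk (fun n => if n = 0 then 0 else f n / (n.factorial : ℝ)) =
          PowerSeries.C b⁻¹ *
            (PowerSeries.rescale (-(a * b)) (PowerSeries.binomialSeries ℝ (-(1 / a) : ℝ)) - 1) →
        IsStieltjesMoment fun n => f (n + 1)) ∧
    -- (v) for `a = 0`, where the generating function is its limit `(exp (b t) - 1) / b`
    (a = 0 → ∀ b : ℝ, 0 < b →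
      ∀ f : ℕ → ℝ,
        PowerSeries.mk (fun n => if n = 0 then 0 else f n / (n.factorial : ℝ)) =
          PowerSeries.C b⁻¹ * (PowerSeries.rescale b (PowerSeries.exp ℝ) - 1) →
        IsStieltjesMoment fun n => f (n + 1)) ∧
    -- (vi)
    (∀ b d l : ℝ, 0 ≤ b → 0 ≤ d → 0 ≤ l → ∀ T : ℕ → ℕ → ℝ,
      IsGenLahTriangle a b b d l T → PreservesSM T) ∧
    -- (vii) `m = a + 1`, `d = 0`, `q` an indeterminate
    (∀ (m : ℕ) (b c l : ℝ) (T : ℕ → ℕ → ℝ), a + 1 = m → IsGenLahTriangle a b c 0 l T →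
      IsBranchedSFraction m
        (branchedCoeffs m (Polynomial.C c * (Polynomial.X + Polynomial.C l)) (Polynomial.C b))
        (PowerSeries.mk fun n => rowPoly T n)) ∧
    -- (vii) the case `q = 0`
    (∀ (m : ℕ) (b c l : ℝ) (T : ℕ → ℕ → ℝ), a + 1 = m → IsGenLahTriangle a b c 0 l T →
      IsBranchedSFraction m (branchedCoeffs m (c * l) b) (PowerSeries.mk fun n => T n 0)) ∧
    -- (viii) rows are PF, and (unless it vanishes identically) `T_n` has only real zeros
    (∀ b c d l : ℝ, 0 ≤ b → 0 ≤ c → 0 ≤ d → 0 ≤ l → ∀ T : ℕ → ℕ → ℝ,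
      IsGenLahTriangle a b c d l T → ∀ n : ℕ,
        IsPF (T n) ∧
        (rowPoly T n ≠ 0 → ∀ z : ℂ, Polynomial.aeval z (rowPoly T n) = 0 → z.im = 0)) := by
  obtain ⟨formula, minors, binomial, exponential, convolution, fraction, rows⟩ :=
    mainTheorem10_general a
  have minors_X {σ : Type} {x y z : σ} {T : ℕ → ℕ → MvPolynomial σ ℝ}
      (hT : IsGenLahTriangle a (.X x) (.X x) (.X y) (.X z) T) :=
    minors _ (nonnegCoeffs σ) 1 (one_mem _) _ (X_mem_nonnegCoeffs x) _ (X_mem_nonnegCoeffs y) _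
      (X_mem_nonnegCoeffs z) _ (one_mul _) T hT
  refine ⟨fun ha b c d l T hT n k => ?_, fun ha b c d l T hT n k => ?_, fun d c hc T hT => ?_,
    fun T hT => (minors_X hT).1, fun T hT => (minors_X hT).2 _ (X_mem_nonnegCoeffs 3),
    fun T hT => ?_, binomial, exponential, fun b d l hb => convolution b b d l hb hb,
    fun m b c l T hm hT => hm ▸ (fraction ℝ b c l T hT).1,
    fun m b c l T hm hT => hm ▸ (fraction ℝ b c l T hT).2,
    fun b c d l hb hc hd hl T hT n => (rows b c d l hb hc hd T hT n).imp_left fun h => h hl⟩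
  · have h := formula ℝ b c d l T hT n k
    simp only [prod_neg_add_sub_mul_eq_descPochhammer (Nat.cast_ne_zero.2 (by omega : a ≠ 0)),
      mul_left_comm _ ((a : ℝ) ^ n), ← mul_sum] at h
    simpa only [← mul_assoc, mul_one_div] using h
  · simpa [ha] using formula ℝ b c d l T hT n k
  · have hu := mul_mem (C_mem_nonnegCoeffs (inv_nonneg.2 hc.le)) (X_mem_nonnegCoeffs (0 : Fin 2))
    refine (minors _ _ _ hu _ (C_mem_nonnegCoeffs hc.le) _ (natCast_mem _ d) _
      (X_mem_nonnegCoeffs 1) _ ?_ T hT).1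
    rw [mul_right_comm, ← MvPolynomial.C_mul, inv_mul_cancel₀ hc.ne', MvPolynomial.C_1, one_mul]
  · have column := (minors_X hT).2 0 (zero_mem _)
    simp only [hT.eval_zero_rowPoly] at column
    exact column
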